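/- Let $f$ be an orientation-preserving $C^2$ diffeomorphism of a closed interval $[a,b]$, $a<b$, different from the identity, all of whose fixed points are parabolic (i.e. $Df(x)=1$ whenever $f(x)=x$). Put $$\Gamma^n_+(f)=\sup_{x\in[a,b]}Df^n(x),\qquad \Gamma^n(f)=\sup_{x\in[a,b]}\max\{Df^n(x),Df^{-n}(x)\}.$$ A component of $f$ is a nondegenerate closed subinterval $I=[c,d]\subseteq[a,b]$ with $f(c)=c$, $f(d)=d$ and no fixed point of $f$ in its interior; $\mathcal C(f)$ denotes the set of components. Then: 1. Each $I\in\mathcal C(f)$ has exactly one topologically repelling endpoint $r_I$ (the endpoint from which $f$ moves all interior points of $I$ away). There is a unique $C^1$ vector field $X_I$ on the half-closed interval $I^{\mathrm o}\cup\{r_I\}$ whose time-$1$ map is the restriction of $f$ (the Szekeres vector field), and it extends continuously to $I$. 2. The sequence $\Gamma^n_+(f)/n^2$ converges to a finite limit, and $$\lim_{n\to\infty}\frac{\Gamma^n_+(f)}{n^2}=\sup_{I\in\mathcal C(f)}\Big[\tfrac12\,|D^2f(r_I)|\cdot\max_{y\in I}|X_I(y)|\Big].$$ This limit is positive if $D^2f(r_I)\neq0$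 for some $I\in\mathcal C(f)$, and it is $0$ if $D^2f(r_I)=0$ for all $I\in\mathcal C(f)$. 3. The sequence $\Gamma^n(f)/n^2$ converges to a finite limit (in particular it is bounded), and this limit is $0$ if $D^2f(x)=0$ at every fixed point $x$ of $f$. -/

import Mathlib

open Set Filter Topology

namespace IntervalDiffeo

/-- The inverse of `f : [a,b] → [a,b]` (its values off `[a,b]` are irrelevant). -/
noncomputable def inverse (a b : ℝ) (f : ℝ → ℝ) : ℝ → ℝ :=
  Function.invFunOn f (Icc a b)

/-- `f` restricts to an orientation-preserving `C²` diffeomorphism of `[a,b]`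
(with one-sided derivatives at the endpoints). -/
structure IsC2Diffeo (a b : ℝ) (f : ℝ → ℝ) : Prop where
  bijOn : BijOn f (Icc a b) (Icc a b)
  monotoneOn : MonotoneOn f (Icc a b)
  contDiffOn : ContDiffOn ℝ 2 f (Icc a b)
  contDiffOn_inverse : ContDiffOn ℝ 2 (inverse a b f) (Icc a b)

/-- All the fixed points of `f` in `[a,b]` are parabolic, that is, the derivative there is `1`. -/
def OnlyParabolicFixedPoints (a b : ℝ) (f : ℝ → ℝ) : Prop :=
  ∀ x ∈ Icc a b, f x = x → derivWithin f (Icc a b) x = 1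

/-- `Γ₊ⁿ(f)`, the supremum over `x ∈ [a,b]` of the derivative of the `n`-th iterate of `f`. -/
noncomputable def gammaPlus (a b : ℝ) (f : ℝ → ℝ) (n : ℕ) : ℝ :=
  sSup ((fun x => derivWithin (f^[n]) (Icc a b) x) '' Icc a b)

/-- `Γⁿ(f)`, the supremum over `x ∈ [a,b]` of the maximum of the derivatives of `fⁿ` and `f⁻ⁿ`. -/
noncomputable def gamma (a b : ℝ) (f : ℝ → ℝ) (n : ℕ) : ℝ :=
  sSup ((fun x => max (derivWithin (f^[n]) (Icc a b) x)
    (derivWithin ((inverse a b f)^[n]) (Icc a b) x)) '' Icc a b)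

/-- The second derivative of `f` at a point of `[a,b]` (one-sided at the endpoints). -/
noncomputable def secondDeriv (a b : ℝ) (f : ℝ → ℝ) (x : ℝ) : ℝ :=
  iteratedDerivWithin 2 f (Icc a b) x

/-- `[c,d]` is a component of `f`: a nondegenerate subinterval of `[a,b]` fixed by `f`
(as `f` is increasing: whose endpoints are fixed) without fixed point in its interior. -/
structure IsComponent (a b : ℝ) (f : ℝ → ℝ) (c d : ℝ) : Prop where
  lt : c < d
  subset : Icc c d ⊆ Icc a b
  fixed_left : f c = c
  fixed_right : f d = d
  ne_of_mem_interior : ∀ x ∈ Ioo c d, f x ≠ x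

/-- `r` is an endpoint of `[c,d]` that is topologically repelling for `f` on `[c,d]`:
`f` moves every interior point away from `r`. -/
def IsRepellingEndpoint (f : ℝ → ℝ) (c d r : ℝ) : Prop :=
  (r = c ∨ r = d) ∧ ∀ x ∈ Ioo c d, |x - r| < |f x - r|

/-- The half-closed interval obtained by adding the endpoint `r` to the interior of `[c,d]`. -/
def halfClosed (c d r : ℝ) : Set ℝ :=
  Ioo c d ∪ {r}

/-- `f` is the time-`1` map of the vector field `X` on `S`: from each `x ∈ S` starts an integral
curve of `X` that stays in `S` and is at `f x` at time `1`. -/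
def IsTimeOneMap (X : ℝ → ℝ) (S : Set ℝ) (f : ℝ → ℝ) : Prop :=
  ∀ x ∈ S, ∃ φ : ℝ → ℝ, φ 0 = x ∧ φ 1 = f x ∧ (∀ t ∈ Icc (0 : ℝ) 1, φ t ∈ S) ∧
    IsIntegralCurveOn φ (fun _ => X) (Icc (0 : ℝ) 1)

/-- `X` is a Szekeres vector field of `f` on the component `[c,d]` with repelling endpoint `r`:
it is `C¹` on the half-closed interval and its time-`1` map there is `f`. -/
structure IsSzekeresField (f : ℝ → ℝ) (c d r : ℝ) (X : ℝ → ℝ) : Prop where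
  contDiffOn : ContDiffOn ℝ 1 X (halfClosed c d r)
  isTimeOneMap : IsTimeOneMap X (halfClosed c d r) f

/-- The set of the numbers `(1/2) |D²f(r_I)| max_{y ∈ I} |X_I(y)|`, where `I` runs over the
components of `f`, and the Szekeres vector field `X_I` is extended continuously to `I`. -/
def growthValues (a b : ℝ) (f : ℝ → ℝ) : Set ℝ :=
  {v | ∃ (c d r : ℝ) (X : ℝ → ℝ) (M : ℝ), IsComponent a b f c d ∧ IsRepellingEndpoint f c d r ∧
    IsSzekeresField f c d r X ∧ ContinuousOn X (Icc c d) ∧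
    IsGreatest ((fun y => |X y|) '' Icc c d) M ∧
    v = 1 / 2 * |secondDeriv a b f r| * M}

end IntervalDiffeo

/-! ### Mean value estimates, and contractions of `[0, L]` that are parabolic at both endpoints. -/

namespace IntervalDiffeo

/-! On a component, put the repelling endpoint of `f` at `0` by an affine chart and work with `g`,
the inverse of `f`, which contracts the component towards `0`. Let `Δ x = x - g x` be the
displacement. By the mean value theorem `Δ (g x) = g' ξ * Δ x` with `ξ` between `g x` and `x`. Since
`log g'` is Lipschitz, the quotients `Δ (g^n x) / (g^n)' x` change from `n` to `n + 1` by a factor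
whose logarithm is at most `C (g^n x - g^(n+1) x)` in absolute value. These bounds telescope, so the
quotients converge to a positive function `X` with `X (g x) = g' x * X x` and `exp (-C x) Δ x ≤ X x
≤ exp (C x) Δ x`. The logarithmic derivatives converge locally uniformly for the same reason, so `X`
is `C¹` up to `0`. A primitive `T` of `1 / X` satisfies `T x - T (g x) = 1`, and inverting `T` gives
integral curves: `X` is the Szekeres field. Any other `C¹` field `Y` with the same time-one map
obeys the same invariance, so `Y / X` is constant along orbits. Both fields are asymptotic to `Δ`
along orbits tending to `0`, so the constant is `1` (`eqOn_szekeres`).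

For the growth, write `y = f^n x`. Then `(f^n)' x = 1 / (g^n)' y = X y / X (g^n y)`, which is
asymptotic to `X y / Δ (g^n y)`. The increment of `1 / √Δ` under one application of `g` tends to
`√(|g'' 0| / 2)` at `0`. Averaging the increments gives `1 / √Δ (g^n y) ~ n √(|g'' 0| / 2)`, hence
`(f^n)' x ~ n² (|g'' 0| / 2) X y`, locally uniformly in `y` (`tendsto_inv_iterDeriv_div_sq`).
Moreover `|g'' 0| = |D²f|` at the endpoint, because the fixed point is parabolic.

There may be infinitely many components, so a bound uniform over all of them is needed. The
inequality `(1 - g')² ≤ 4 C Δ` bounds every increment of `1 / √Δ` by a constant depending only on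
`C`, and gives `(f^n)' x ≤ K (1 + n² |y - g y|)` with one `K` for all of `[a, b]`
(`exists_inv_iterDeriv_le`). Where the displacement is small this bound suffices; where it is
bounded below, compactness and the locally uniform limits do (`eventually_inv_iterDeriv_div_sq_le`).
Iterates of both signs follow by applying the result to `f` and to its inverse and taking the
maximum. -/

/-- The mean value theorem, in product form. -/
theorem exists_sub_eq_deriv_mul {h h' : ℝ → ℝ} {s t : ℝ} (hst : s < t)
    (hc : ContinuousOn h (Icc s t)) (hd : ∀ x ∈ Ioo s t, HasDerivAt h (h' x) x) :
    ∃ ξ ∈ Ioo s t, h t - h s = h' ξ * (t - s) := by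
  obtain ⟨ξ, hξ, he⟩ := exists_hasDerivAt_eq_slope h h' hst hc hd
  refine ⟨ξ, hξ, ?_⟩
  rw [he, div_mul_cancel₀]
  linarith

theorem abs_sub_le_of_abs_deriv_le {h h' : ℝ → ℝ} {u v K : ℝ}
    (hc : ContinuousOn h (Icc u v)) (hd : ∀ x ∈ Ioo u v, HasDerivAt h (h' x) x)
    (hb : ∀ x ∈ Ioo u v, |h' x| ≤ K) {s t : ℝ} (hs : s ∈ Icc u v) (ht : t ∈ Icc u v) :
    |h t - h s| ≤ K * |t - s| := by
  wlog hst : s < t generalizing s t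
  · rcases (not_lt.1 hst).eq_or_lt with rfl | h'
    · simp
    · rw [abs_sub_comm, abs_sub_comm t]
      exact this ht hs h'
  obtain ⟨ξ, hξ, he⟩ := exists_sub_eq_deriv_mul hst (hc.mono (Icc_subset_Icc hs.1 ht.2))
    (fun x hx => hd x (Ioo_subset_Ioo hs.1 ht.2 hx))
  rw [he, abs_mul]
  gcongr
  exact hb ξ (Ioo_subset_Ioo hs.1 ht.2 hξ)

/-- The displacement `x - g x`. -/
def disp (g : ℝ → ℝ) (x : ℝ) : ℝ := x - g x

/-- The derivative of `g^[n]` at `x`, by the chain rule, in terms of the derivative `g₁` of `g`. -/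
noncomputable def iterDeriv (g g₁ : ℝ → ℝ) (n : ℕ) (x : ℝ) : ℝ :=
  ∏ i ∈ Finset.range n, g₁ (g^[i] x)

theorem iterDeriv_succ (g g₁ : ℝ → ℝ) (n : ℕ) (x : ℝ) :
    iterDeriv g g₁ (n + 1) x = iterDeriv g g₁ n x * g₁ (g^[n] x) :=
  Finset.prod_range_succ _ _

/-- `g` is a `C²` diffeomorphism of `[0, L]`, with first two derivatives `g₁` and `g₂`, that is
parabolic at both endpoints and moves all interior points towards `0`. The constant `C` controls
the length of the interval and the derivatives. -/
structure ParabolicContraction (C L : ℝ) (g g₁ g₂ : ℝ → ℝ) : Prop where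
  pos : 0 < L
  le : L ≤ C
  map_zero : g 0 = 0
  map_right : g L = L
  lt_self : ∀ x ∈ Ioo 0 L, g x < x
  continuousOn : ContinuousOn g (Icc 0 L)
  continuousOn₁ : ContinuousOn g₁ (Icc 0 L)
  continuousOn₂ : ContinuousOn g₂ (Icc 0 L)
  hasDerivAt : ∀ x ∈ Ioo 0 L, HasDerivAt g (g₁ x) x
  hasDerivAt₁ : ∀ x ∈ Ioo 0 L, HasDerivAt g₁ (g₂ x) x
  deriv_zero : g₁ 0 = 1
  deriv_right : g₁ L = 1
  one_le : ∀ x ∈ Icc 0 L, 1 ≤ C * g₁ x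
  abs_deriv₂_le : ∀ x ∈ Icc 0 L, |g₂ x| ≤ C
  abs_deriv₂_le_mul : ∀ x ∈ Icc 0 L, |g₂ x| ≤ C * g₁ x

namespace ParabolicContraction

variable {C L : ℝ} {g g₁ g₂ : ℝ → ℝ}

theorem C_pos (h : ParabolicContraction C L g g₁ g₂) : 0 < C := h.pos.trans_le h.le

theorem deriv_pos (h : ParabolicContraction C L g g₁ g₂) {x : ℝ} (hx : x ∈ Icc 0 L) :
    0 < g₁ x := by
  have := h.one_le x hx
  exact pos_of_mul_pos_right (by linarith) h.C_pos.le

theorem strictMonoOn (h : ParabolicContraction C L g g₁ g₂) : StrictMonoOn g (Icc 0 L) := by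
  apply strictMonoOn_of_deriv_pos (convex_Icc 0 L) h.continuousOn
  intro x hx
  rw [interior_Icc] at hx
  rw [(h.hasDerivAt x hx).deriv]
  exact h.deriv_pos (Ioo_subset_Icc_self hx)

theorem mapsTo (h : ParabolicContraction C L g g₁ g₂) : MapsTo g (Ioo 0 L) (Ioo 0 L) := by
  intro x hx
  refine ⟨?_, (h.lt_self x hx).trans hx.2⟩
  have := h.strictMonoOn (left_mem_Icc.2 h.pos.le) (Ioo_subset_Icc_self hx) hx.1
  rwa [h.map_zero] at this

theorem iterate_mem (h : ParabolicContraction C L g g₁ g₂) {x : ℝ} (hx : x ∈ Ioo 0 L) (n : ℕ) :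
    g^[n] x ∈ Ioo 0 L :=
  h.mapsTo.iterate n hx

theorem iterate_succ_lt (h : ParabolicContraction C L g g₁ g₂) {x : ℝ} (hx : x ∈ Ioo 0 L)
    (n : ℕ) : g^[n + 1] x < g^[n] x := by
  rw [Function.iterate_succ_apply']
  exact h.lt_self _ (h.iterate_mem hx n)

theorem iterate_antitone (h : ParabolicContraction C L g g₁ g₂) {x : ℝ} (hx : x ∈ Ioo 0 L) :
    Antitone fun n => g^[n] x :=
  antitone_nat_of_succ_le fun n => (h.iterate_succ_lt hx n).le

theorem iterate_le_self (h : ParabolicContraction C L g g₁ g₂) {x : ℝ} (hx : x ∈ Ioo 0 L)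
    (n : ℕ) : g^[n] x ≤ x :=
  h.iterate_antitone hx (Nat.zero_le n)

theorem iterate_mono (h : ParabolicContraction C L g g₁ g₂) {x y : ℝ} (hx : x ∈ Ioo 0 L)
    (hy : y ∈ Ioo 0 L) (hxy : x ≤ y) (n : ℕ) : g^[n] x ≤ g^[n] y := by
  induction n with
  | zero => exact hxy
  | succ n ih =>
    rw [Function.iterate_succ_apply', Function.iterate_succ_apply']
    exact h.strictMonoOn.monotoneOn (Ioo_subset_Icc_self (h.iterate_mem hx n))
      (Ioo_subset_Icc_self (h.iterate_mem hy n)) ih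

theorem tendsto_iterate (h : ParabolicContraction C L g g₁ g₂) {x : ℝ} (hx : x ∈ Ioo 0 L) :
    Tendsto (fun n => g^[n] x) atTop (𝓝 0) := by
  have hb : BddBelow (range fun n => g^[n] x) := by
    refine ⟨0, ?_⟩
    rintro _ ⟨n, rfl⟩
    exact (h.iterate_mem hx n).1.le
  have ht := tendsto_atTop_ciInf (h.iterate_antitone hx) hb
  set l := ⨅ n, g^[n] x
  have hl0 : 0 ≤ l := ge_of_tendsto' ht fun n => (h.iterate_mem hx n).1.le
  have hlx : l ≤ x := le_of_tendsto' ht fun n => h.iterate_le_self hx n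
  rcases hl0.eq_or_lt with h0 | h0
  · rwa [← h0] at ht
  exfalso
  have hl : l ∈ Ioo 0 L := ⟨h0, hlx.trans_lt hx.2⟩
  have h1 : Tendsto (fun n => g (g^[n] x)) atTop (𝓝 (g l)) :=
    ((h.hasDerivAt l hl).continuousAt.tendsto).comp ht
  have h2 : Tendsto (fun n => g (g^[n] x)) atTop (𝓝 l) := by
    have := (tendsto_add_atTop_iff_nat 1).2 ht
    simpa only [Function.iterate_succ_apply'] using this
  exact (h.lt_self l hl).ne (tendsto_nhds_unique h1 h2)

theorem disp_pos (h : ParabolicContraction C L g g₁ g₂) {x : ℝ} (hx : x ∈ Ioo 0 L) :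
    0 < disp g x :=
  sub_pos.2 (h.lt_self x hx)

theorem disp_nonneg (h : ParabolicContraction C L g g₁ g₂) {x : ℝ} (hx : x ∈ Icc 0 L) :
    0 ≤ disp g x := by
  rcases eq_endpoints_or_mem_Ioo_of_mem_Icc hx with rfl | rfl | hx
  · simp [disp, h.map_zero]
  · simp [disp, h.map_right]
  · exact (h.disp_pos hx).le

theorem disp_le_self (h : ParabolicContraction C L g g₁ g₂) {x : ℝ} (hx : x ∈ Ioo 0 L) :
    disp g x ≤ x := by
  have := (h.mapsTo hx).1
  simp only [disp]
  linarith

theorem continuousOn_disp (h : ParabolicContraction C L g g₁ g₂) :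
    ContinuousOn (disp g) (Icc 0 L) :=
  continuousOn_id.sub h.continuousOn

theorem hasDerivAt_disp (h : ParabolicContraction C L g g₁ g₂) {x : ℝ} (hx : x ∈ Ioo 0 L) :
    HasDerivAt (disp g) (1 - g₁ x) x :=
  (hasDerivAt_id x).sub (h.hasDerivAt x hx)

theorem abs_deriv_sub_le (h : ParabolicContraction C L g g₁ g₂) {s t : ℝ} (hs : s ∈ Icc 0 L)
    (ht : t ∈ Icc 0 L) : |g₁ t - g₁ s| ≤ C * |t - s| :=
  abs_sub_le_of_abs_deriv_le h.continuousOn₁ h.hasDerivAt₁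
    (fun x hx => h.abs_deriv₂_le x (Ioo_subset_Icc_self hx)) hs ht

theorem abs_log_deriv_sub_le (h : ParabolicContraction C L g g₁ g₂) {s t : ℝ}
    (hs : s ∈ Icc 0 L) (ht : t ∈ Icc 0 L) :
    |Real.log (g₁ t) - Real.log (g₁ s)| ≤ C * |t - s| := by
  refine abs_sub_le_of_abs_deriv_le (h := fun x => Real.log (g₁ x)) (h' := fun x => g₂ x / g₁ x)
    (h.continuousOn₁.log fun x hx => (h.deriv_pos hx).ne')
    (fun x hx => (h.hasDerivAt₁ x hx).log (h.deriv_pos (Ioo_subset_Icc_self hx)).ne') ?_ hs ht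
  intro x hx
  have hx' := Ioo_subset_Icc_self hx
  rw [abs_div, abs_of_pos (h.deriv_pos hx'), div_le_iff₀ (h.deriv_pos hx')]
  exact h.abs_deriv₂_le_mul x hx'

theorem exists_disp_apply_eq (h : ParabolicContraction C L g g₁ g₂) {x : ℝ} (hx : x ∈ Ioo 0 L) :
    ∃ ξ ∈ Ioo (g x) x, disp g (g x) = g₁ ξ * disp g x := by
  have h1 := h.mapsTo hx
  exact exists_sub_eq_deriv_mul (h.lt_self x hx)
    (h.continuousOn.mono (Icc_subset_Icc h1.1.le hx.2.le))
    (fun y hy => h.hasDerivAt y (Ioo_subset_Ioo h1.1.le hx.2.le hy))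

theorem iterDeriv_pos (h : ParabolicContraction C L g g₁ g₂) {x : ℝ} (hx : x ∈ Ioo 0 L) (n : ℕ) :
    0 < iterDeriv g g₁ n x :=
  Finset.prod_pos fun i _ => h.deriv_pos (Ioo_subset_Icc_self (h.iterate_mem hx i))

theorem hasDerivAt_iterate (h : ParabolicContraction C L g g₁ g₂) {x : ℝ} (hx : x ∈ Ioo 0 L)
    (n : ℕ) : HasDerivAt (g^[n]) (iterDeriv g g₁ n x) x := by
  induction n with
  | zero => simpa [iterDeriv] using hasDerivAt_id x
  | succ n ih =>
    rw [Function.iterate_succ', iterDeriv_succ, mul_comm]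
    exact (h.hasDerivAt _ (h.iterate_mem hx n)).comp x ih

end ParabolicContraction

/-! ### The Szekeres field as a limit, and its regularity inside the interval. -/

/-- The logarithm of `disp g (g^[n] x)` over the derivative of `g^[n]` at `x`; these functions
converge to the logarithm of the Szekeres vector field. -/
noncomputable def logApprox (g g₁ : ℝ → ℝ) (n : ℕ) (x : ℝ) : ℝ :=
  Real.log (disp g (g^[n] x)) - ∑ i ∈ Finset.range n, Real.log (g₁ (g^[i] x))

/-- The logarithm of the Szekeres vector field. -/
noncomputable def logField (g g₁ : ℝ → ℝ) (x : ℝ) : ℝ :=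
  limUnder atTop fun n => logApprox g g₁ n x

/-- The derivative of `logApprox g g₁ n`. -/
noncomputable def logApproxDeriv (g g₁ g₂ : ℝ → ℝ) (n : ℕ) (x : ℝ) : ℝ :=
  (1 - g₁ (g^[n] x)) * iterDeriv g g₁ n x / disp g (g^[n] x) -
    ∑ i ∈ Finset.range n, g₂ (g^[i] x) / g₁ (g^[i] x) * iterDeriv g g₁ i x

/-- The derivative of `logField g g₁`. -/
noncomputable def logFieldDeriv (g g₁ g₂ : ℝ → ℝ) (x : ℝ) : ℝ :=
  -∑' i, g₂ (g^[i] x) / g₁ (g^[i] x) * iterDeriv g g₁ i x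

/-- The Szekeres vector field of the inverse of `g` on `[0, L]`. -/
noncomputable def szekeres (L : ℝ) (g g₁ : ℝ → ℝ) (x : ℝ) : ℝ :=
  (Ioo 0 L).indicator (fun y => Real.exp (logField g g₁ y)) x

namespace ParabolicContraction

variable {C L : ℝ} {g g₁ g₂ : ℝ → ℝ}

/-- The displacement is multiplied by `g₁ ξ` and the derivative of the iterate by `g₁ (g^[n] x)`, at
two points of the same fundamental interval. As `log g₁` is Lipschitz, the error is controlled by
the length of that interval, and these lengths telescope along the orbit. -/
theorem abs_logApprox_succ_sub_le (h : ParabolicContraction C L g g₁ g₂) {x : ℝ}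
    (hx : x ∈ Ioo 0 L) (n : ℕ) :
    |logApprox g g₁ (n + 1) x - logApprox g g₁ n x| ≤ C * (g^[n] x - g^[n + 1] x) := by
  have hy := h.iterate_mem hx n
  have hy1 := h.iterate_mem hx (n + 1)
  obtain ⟨ξ, hξ, he⟩ := h.exists_disp_apply_eq hy
  rw [← Function.iterate_succ_apply' g n x] at hξ he
  have hξ' : ξ ∈ Icc 0 L := ⟨(hy1.1.trans hξ.1).le, (hξ.2.trans hy.2).le⟩
  have e : logApprox g g₁ (n + 1) x - logApprox g g₁ n x =
      Real.log (g₁ ξ) - Real.log (g₁ (g^[n] x)) := by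
    rw [logApprox, logApprox, he, Real.log_mul (h.deriv_pos hξ').ne' (h.disp_pos hy).ne',
      Finset.sum_range_succ]
    ring
  rw [e]
  refine (h.abs_log_deriv_sub_le (Ioo_subset_Icc_self hy) hξ').trans ?_
  have := h.C_pos.le
  gcongr
  rw [abs_sub_comm, abs_of_pos (by linarith [hξ.2])]
  linarith [hξ.1]

theorem abs_logApprox_sub_le (h : ParabolicContraction C L g g₁ g₂) {x : ℝ}
    (hx : x ∈ Ioo 0 L) {n m : ℕ} (hnm : n ≤ m) :
    |logApprox g g₁ m x - logApprox g g₁ n x| ≤ C * (g^[n] x - g^[m] x) := by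
  induction m, hnm using Nat.le_induction with
  | base => simp
  | succ m hm ih =>
    have := h.abs_logApprox_succ_sub_le hx m
    calc _ ≤ |logApprox g g₁ (m + 1) x - logApprox g g₁ m x| +
          |logApprox g g₁ m x - logApprox g g₁ n x| := abs_sub_le _ _ _
      _ ≤ C * (g^[m] x - g^[m + 1] x) + C * (g^[n] x - g^[m] x) := add_le_add this ih
      _ = _ := by ring

theorem tendsto_logApprox (h : ParabolicContraction C L g g₁ g₂) {x : ℝ} (hx : x ∈ Ioo 0 L) :
    Tendsto (fun n => logApprox g g₁ n x) atTop (𝓝 (logField g g₁ x)) := by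
  have : CauchySeq fun n => logApprox g g₁ n x := by
    apply cauchySeq_of_le_tendsto_0' (fun n => C * g^[n] x)
    · intro n m hnm
      rw [dist_comm, Real.dist_eq]
      refine (h.abs_logApprox_sub_le hx hnm).trans ?_
      have := h.C_pos.le
      gcongr
      linarith [(h.iterate_mem hx m).1]
    · simpa using (h.tendsto_iterate hx).const_mul C
  exact this.tendsto_limUnder

theorem abs_logField_sub_logApprox_le (h : ParabolicContraction C L g g₁ g₂) {x : ℝ}
    (hx : x ∈ Ioo 0 L) (n : ℕ) :
    |logField g g₁ x - logApprox g g₁ n x| ≤ C * g^[n] x := by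
  refine le_of_tendsto ((h.tendsto_logApprox hx).sub_const _).abs ?_
  filter_upwards [eventually_ge_atTop n] with m hm
  refine (h.abs_logApprox_sub_le hx hm).trans ?_
  have := h.C_pos.le
  gcongr
  linarith [(h.iterate_mem hx m).1]

theorem abs_logField_sub_log_disp_le (h : ParabolicContraction C L g g₁ g₂) {x : ℝ}
    (hx : x ∈ Ioo 0 L) : |logField g g₁ x - Real.log (disp g x)| ≤ C * x := by
  simpa [logApprox] using h.abs_logField_sub_logApprox_le hx 0

/-- The approximation of index `n` at `g x` is that of index `n + 1` at `x` with the first factor of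
the derivative removed. In exponential form this is the invariance of the field under `g`. -/
theorem logField_apply (h : ParabolicContraction C L g g₁ g₂) {x : ℝ} (hx : x ∈ Ioo 0 L) :
    logField g g₁ (g x) = logField g g₁ x + Real.log (g₁ x) := by
  refine tendsto_nhds_unique (h.tendsto_logApprox (h.mapsTo hx)) ?_
  have := ((tendsto_add_atTop_iff_nat 1).2 (h.tendsto_logApprox hx)).add_const (Real.log (g₁ x))
  refine this.congr fun n => ?_
  simp only [logApprox, Finset.sum_range_succ', Function.iterate_succ_apply,
    Function.iterate_zero_apply]
  ring

theorem logField_iterate (h : ParabolicContraction C L g g₁ g₂) {x : ℝ} (hx : x ∈ Ioo 0 L)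
    (n : ℕ) : logField g g₁ (g^[n] x) = logField g g₁ x + Real.log (iterDeriv g g₁ n x) := by
  induction n with
  | zero => simp [iterDeriv]
  | succ n ih =>
    have hp := h.iterate_mem hx n
    rw [Function.iterate_succ_apply', h.logField_apply hp, ih, iterDeriv_succ,
      Real.log_mul (h.iterDeriv_pos hx n).ne'
        (h.deriv_pos (Ioo_subset_Icc_self hp)).ne', add_assoc]

theorem szekeres_of_mem {x : ℝ} (hx : x ∈ Ioo 0 L) :
    szekeres L g g₁ x = Real.exp (logField g g₁ x) :=
  indicator_of_mem hx _

theorem szekeres_zero : szekeres L g g₁ 0 = 0 :=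
  indicator_of_notMem (by simp) _

theorem szekeres_right : szekeres L g g₁ L = 0 :=
  indicator_of_notMem (by simp) _

theorem szekeres_nonneg (x : ℝ) : 0 ≤ szekeres L g g₁ x :=
  indicator_nonneg (fun _ _ => (Real.exp_pos _).le) x

theorem szekeres_pos {x : ℝ} (hx : x ∈ Ioo 0 L) : 0 < szekeres L g g₁ x := by
  rw [szekeres_of_mem hx]
  exact Real.exp_pos _

theorem szekeres_iterate (h : ParabolicContraction C L g g₁ g₂) {x : ℝ} (hx : x ∈ Ioo 0 L)
    (n : ℕ) : szekeres L g g₁ (g^[n] x) = iterDeriv g g₁ n x * szekeres L g g₁ x := by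
  rw [szekeres_of_mem (h.iterate_mem hx n), szekeres_of_mem hx, h.logField_iterate hx n,
    Real.exp_add, Real.exp_log (h.iterDeriv_pos hx n), mul_comm]

theorem szekeres_apply (h : ParabolicContraction C L g g₁ g₂) {x : ℝ} (hx : x ∈ Ioo 0 L) :
    szekeres L g g₁ (g x) = g₁ x * szekeres L g g₁ x := by
  simpa [iterDeriv] using h.szekeres_iterate hx 1

theorem szekeres_le (h : ParabolicContraction C L g g₁ g₂) {x : ℝ} (hx : x ∈ Ioo 0 L) :
    szekeres L g g₁ x ≤ Real.exp (C * x) * disp g x := by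
  have := (abs_le.1 (h.abs_logField_sub_log_disp_le hx)).2
  rw [szekeres_of_mem hx, ← Real.exp_log (h.disp_pos hx), ← Real.exp_add]
  gcongr
  linarith

theorem le_szekeres (h : ParabolicContraction C L g g₁ g₂) {x : ℝ} (hx : x ∈ Ioo 0 L) :
    Real.exp (-(C * x)) * disp g x ≤ szekeres L g g₁ x := by
  have := (abs_le.1 (h.abs_logField_sub_log_disp_le hx)).1
  rw [szekeres_of_mem hx, ← Real.exp_log (h.disp_pos hx), ← Real.exp_add]
  gcongr
  linarith

theorem mul_self_le (h : ParabolicContraction C L g g₁ g₂) {x : ℝ} (hx : x ∈ Ioo 0 L) :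
    C * x ≤ C * C := by
  have := h.C_pos
  gcongr
  exact hx.2.le.trans h.le

theorem szekeres_le' (h : ParabolicContraction C L g g₁ g₂) {x : ℝ} (hx : x ∈ Ioo 0 L) :
    szekeres L g g₁ x ≤ Real.exp (C * C) * disp g x := by
  refine (h.szekeres_le hx).trans ?_
  have := h.mul_self_le hx
  have := (h.disp_pos hx).le
  gcongr

theorem disp_le_szekeres (h : ParabolicContraction C L g g₁ g₂) {x : ℝ} (hx : x ∈ Ioo 0 L) :
    disp g x ≤ Real.exp (C * C) * szekeres L g g₁ x := by
  have h1 := h.le_szekeres hx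
  rw [Real.exp_neg, inv_mul_le_iff₀ (Real.exp_pos _)] at h1
  refine h1.trans ?_
  have := h.mul_self_le hx
  have := (szekeres_pos (g := g) (g₁ := g₁) hx).le
  gcongr

/-- The distortion of the iterates is bounded. -/
theorem iterDeriv_mul_disp_le (h : ParabolicContraction C L g g₁ g₂) {x : ℝ} (hx : x ∈ Ioo 0 L)
    (n : ℕ) :
    iterDeriv g g₁ n x * disp g x ≤ Real.exp (C * C) ^ 2 * disp g (g^[n] x) := by
  have h2 := (h.iterDeriv_pos hx n).le
  calc iterDeriv g g₁ n x * disp g x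
      ≤ iterDeriv g g₁ n x * (Real.exp (C * C) * szekeres L g g₁ x) := by
        gcongr; exact h.disp_le_szekeres hx
    _ = Real.exp (C * C) * szekeres L g g₁ (g^[n] x) := by rw [h.szekeres_iterate hx]; ring
    _ ≤ Real.exp (C * C) * (Real.exp (C * C) * disp g (g^[n] x)) := by
        gcongr; exact h.szekeres_le' (h.iterate_mem hx n)
    _ = _ := by ring

theorem hasDerivAt_logApprox (h : ParabolicContraction C L g g₁ g₂) {x : ℝ} (hx : x ∈ Ioo 0 L)
    (n : ℕ) : HasDerivAt (logApprox g g₁ n) (logApproxDeriv g g₁ g₂ n x) x := by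
  unfold logApproxDeriv
  refine HasDerivAt.sub ?_ ?_
  · exact ((h.hasDerivAt_disp (h.iterate_mem hx n)).comp x (h.hasDerivAt_iterate hx n)).log
      (h.disp_pos (h.iterate_mem hx n)).ne'
  · refine HasDerivAt.fun_sum fun i _ => ?_
    have hp := h.iterate_mem hx i
    have := ((h.hasDerivAt₁ _ hp).comp x (h.hasDerivAt_iterate hx i)).log
      (h.deriv_pos (Ioo_subset_Icc_self hp)).ne'
    rw [div_mul_eq_mul_div]
    exact this

/-- Bounded distortion makes the derivative of the `i`-th iterate comparable to the ratio of
displacements, so the series for the logarithmic derivative is dominated by a telescoping one. -/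
theorem abs_term_le (h : ParabolicContraction C L g g₁ g₂) {x : ℝ} (hx : x ∈ Ioo 0 L) (i : ℕ) :
    |g₂ (g^[i] x) / g₁ (g^[i] x) * iterDeriv g g₁ i x| ≤
      C * Real.exp (C * C) ^ 2 / disp g x * (g^[i] x - g^[i + 1] x) := by
  have hp := Ioo_subset_Icc_self (h.iterate_mem hx i)
  have h1 : |g₂ (g^[i] x) / g₁ (g^[i] x)| ≤ C := by
    rw [abs_div, abs_of_pos (h.deriv_pos hp), div_le_iff₀ (h.deriv_pos hp)]
    exact h.abs_deriv₂_le_mul _ hp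
  have h2 : iterDeriv g g₁ i x ≤ Real.exp (C * C) ^ 2 * disp g (g^[i] x) / disp g x := by
    rw [le_div_iff₀ (h.disp_pos hx)]
    exact h.iterDeriv_mul_disp_le hx i
  rw [abs_mul, abs_of_pos (h.iterDeriv_pos hx i)]
  have h3 := (h.iterDeriv_pos hx i).le
  have := h.C_pos.le
  calc _ ≤ C * (Real.exp (C * C) ^ 2 * disp g (g^[i] x) / disp g x) := by gcongr
    _ = _ := by rw [Function.iterate_succ_apply', disp]; ring

theorem sum_abs_term_le (h : ParabolicContraction C L g g₁ g₂) {x : ℝ} (hx : x ∈ Ioo 0 L)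
    {n m : ℕ} (hnm : n ≤ m) :
    ∑ i ∈ Finset.Ico n m, |g₂ (g^[i] x) / g₁ (g^[i] x) * iterDeriv g g₁ i x| ≤
      C * Real.exp (C * C) ^ 2 / disp g x * g^[n] x := by
  refine (Finset.sum_le_sum fun i _ => h.abs_term_le hx i).trans ?_
  rw [← Finset.mul_sum]
  have := h.C_pos.le
  have := (h.disp_pos hx).le
  have e : ∑ i ∈ Finset.Ico n m, (g^[i] x - g^[i + 1] x) = g^[n] x - g^[m] x := by
    have := Finset.sum_Ico_sub (fun i => g^[i] x) hnm
    rw [← neg_sub (g^[m] x), ← this, ← Finset.sum_neg_distrib]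
    exact Finset.sum_congr rfl fun i _ => by ring
  rw [e]
  gcongr
  linarith [(h.iterate_mem hx m).1]

theorem summable_term (h : ParabolicContraction C L g g₁ g₂) {x : ℝ} (hx : x ∈ Ioo 0 L) :
    Summable fun i => g₂ (g^[i] x) / g₁ (g^[i] x) * iterDeriv g g₁ i x := by
  apply Summable.of_abs
  refine summable_of_sum_range_le (c := C * Real.exp (C * C) ^ 2 / disp g x * x)
    (fun _ => abs_nonneg _) fun n => ?_
  rw [Finset.range_eq_Ico]
  exact h.sum_abs_term_le hx (Nat.zero_le n)

theorem abs_logFieldDeriv_add_sum_le (h : ParabolicContraction C L g g₁ g₂) {x : ℝ}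
    (hx : x ∈ Ioo 0 L) (n : ℕ) :
    |logFieldDeriv g g₁ g₂ x +
        ∑ i ∈ Finset.range n, g₂ (g^[i] x) / g₁ (g^[i] x) * iterDeriv g g₁ i x| ≤
      C * Real.exp (C * C) ^ 2 / disp g x * g^[n] x := by
  have ht := (h.summable_term hx).hasSum.tendsto_sum_nat
  refine le_of_tendsto ((ht.neg).add_const _).abs ?_
  filter_upwards [eventually_ge_atTop n] with m hm
  refine le_trans ?_ (h.sum_abs_term_le hx hm)
  rw [neg_add_eq_sub, abs_sub_comm, ← Finset.sum_Ico_eq_sub _ hm]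
  exact Finset.abs_sum_le_sum_abs _ _

theorem abs_one_sub_deriv_le (h : ParabolicContraction C L g g₁ g₂) {x : ℝ} (hx : x ∈ Icc 0 L) :
    |1 - g₁ x| ≤ C * x := by
  have := h.abs_deriv_sub_le hx (left_mem_Icc.2 h.pos.le)
  rwa [h.deriv_zero, zero_sub, abs_neg, abs_of_nonneg hx.1] at this

/-- The boundary term disappears in the limit because `1 - g₁` is `O(x)` at the parabolic point `0`.
It and the tail of the series contribute equal bounds, whence the factor `2`. -/
theorem abs_logApproxDeriv_sub_le (h : ParabolicContraction C L g g₁ g₂) {x : ℝ}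
    (hx : x ∈ Ioo 0 L) (n : ℕ) :
    |logFieldDeriv g g₁ g₂ x - logApproxDeriv g g₁ g₂ n x| ≤
      2 * C * Real.exp (C * C) ^ 2 / disp g x * g^[n] x := by
  have h1 := h.abs_logFieldDeriv_add_sum_le hx n
  have hp := h.iterate_mem hx n
  have h2 : |(1 - g₁ (g^[n] x)) * iterDeriv g g₁ n x / disp g (g^[n] x)| ≤
      C * Real.exp (C * C) ^ 2 / disp g x * g^[n] x := by
    have h3 : iterDeriv g g₁ n x / disp g (g^[n] x) ≤ Real.exp (C * C) ^ 2 / disp g x := by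
      rw [div_le_div_iff₀ (h.disp_pos hp) (h.disp_pos hx)]
      exact h.iterDeriv_mul_disp_le hx n
    have h4 : 0 ≤ iterDeriv g g₁ n x / disp g (g^[n] x) :=
      div_nonneg (h.iterDeriv_pos hx n).le (h.disp_pos hp).le
    rw [mul_div_assoc, abs_mul, abs_of_nonneg h4]
    have := h.C_pos
    have := hp.1
    calc _ ≤ (C * g^[n] x) * (Real.exp (C * C) ^ 2 / disp g x) := by
          gcongr
          exact h.abs_one_sub_deriv_le (Ioo_subset_Icc_self hp)
      _ = _ := by ring
  rw [logApproxDeriv, ← sub_add, sub_add_eq_add_sub]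
  refine (abs_sub _ _).trans ?_
  calc _ ≤ _ := add_le_add h1 h2
    _ = _ := by ring

theorem tendstoLocallyUniformlyOn_logApproxDeriv (h : ParabolicContraction C L g g₁ g₂) :
    TendstoLocallyUniformlyOn (logApproxDeriv g g₁ g₂) (logFieldDeriv g g₁ g₂) atTop
      (Ioo 0 L) := by
  rw [Metric.tendstoLocallyUniformlyOn_iff]
  intro ε hε x hx
  -- By monotonicity the orbit of this point dominates the orbits of all points near `x`, which
  -- makes the pointwise error bound uniform there once the displacement is bounded below.
  have hx2 : (x + L) / 2 ∈ Ioo 0 L := ⟨by linarith [hx.1, h.pos], by linarith [hx.2]⟩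
  have hd := h.disp_pos hx
  have h1 : ∀ᶠ y in 𝓝 x, disp g x / 2 < disp g y :=
    (h.hasDerivAt_disp hx).continuousAt.eventually (lt_mem_nhds (by linarith))
  have h2 : ∀ᶠ y in 𝓝 x, y < (x + L) / 2 := gt_mem_nhds (by linarith [hx.2])
  refine ⟨{y | disp g x / 2 < disp g y ∧ y < (x + L) / 2 ∧ y ∈ Ioo 0 L},
    mem_nhdsWithin_of_mem_nhds (h1.and (h2.and (isOpen_Ioo.mem_nhds hx))), ?_⟩
  have ht := (h.tendsto_iterate hx2).const_mul (2 * C * Real.exp (C * C) ^ 2 / (disp g x / 2))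
  rw [mul_zero] at ht
  filter_upwards [ht.eventually (gt_mem_nhds hε)] with n hn y hy
  rw [Real.dist_eq]
  refine ((h.abs_logApproxDeriv_sub_le hy.2.2 n).trans ?_).trans_lt hn
  have := h.C_pos
  have h3 := hy.1.le
  have h4 := h.iterate_mono hy.2.2 hx2 hy.2.1.le n
  have := (h.iterate_mem hy.2.2 n).1.le
  gcongr

theorem continuousOn_iterDeriv (h : ParabolicContraction C L g g₁ g₂) (n : ℕ) :
    ContinuousOn (iterDeriv g g₁ n) (Ioo 0 L) := by
  refine continuousOn_finsetProd _ fun i _ => ?_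
  exact (h.continuousOn₁.mono Ioo_subset_Icc_self).comp
    (fun x hx => (h.hasDerivAt_iterate hx i).continuousAt.continuousWithinAt)
    fun x hx => h.iterate_mem hx i

theorem continuousOn_logApproxDeriv (h : ParabolicContraction C L g g₁ g₂) (n : ℕ) :
    ContinuousOn (logApproxDeriv g g₁ g₂ n) (Ioo 0 L) := by
  have hi : ∀ i, ContinuousOn (g^[i]) (Ioo 0 L) := fun i x hx =>
    (h.hasDerivAt_iterate hx i).continuousAt.continuousWithinAt
  have hm : ∀ i, MapsTo (g^[i]) (Ioo 0 L) (Icc 0 L) := fun i x hx =>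
    Ioo_subset_Icc_self (h.iterate_mem hx i)
  refine ContinuousOn.sub (ContinuousOn.div ((continuousOn_const.sub
    (h.continuousOn₁.comp (hi n) (hm n))).mul (h.continuousOn_iterDeriv n))
    (h.continuousOn_disp.comp (hi n) (hm n))
    fun x hx => (h.disp_pos (h.iterate_mem hx n)).ne') ?_
  refine continuousOn_finsetSum _ fun i _ => ?_
  exact ((h.continuousOn₂.comp (hi i) (hm i)).div (h.continuousOn₁.comp (hi i) (hm i))
    fun x hx => (h.deriv_pos (hm i hx)).ne').mul (h.continuousOn_iterDeriv i)

theorem continuousOn_logFieldDeriv (h : ParabolicContraction C L g g₁ g₂) :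
    ContinuousOn (logFieldDeriv g g₁ g₂) (Ioo 0 L) :=
  h.tendstoLocallyUniformlyOn_logApproxDeriv.continuousOn
    (Frequently.of_forall h.continuousOn_logApproxDeriv)

theorem hasDerivAt_logField (h : ParabolicContraction C L g g₁ g₂) {x : ℝ} (hx : x ∈ Ioo 0 L) :
    HasDerivAt (logField g g₁) (logFieldDeriv g g₁ g₂ x) x :=
  hasDerivAt_of_tendstoLocallyUniformlyOn isOpen_Ioo h.tendstoLocallyUniformlyOn_logApproxDeriv
    (Eventually.of_forall fun n _ hy => h.hasDerivAt_logApprox hy n)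
    (fun _ hy => h.tendsto_logApprox hy) hx

theorem hasDerivAt_szekeres (h : ParabolicContraction C L g g₁ g₂) {x : ℝ} (hx : x ∈ Ioo 0 L) :
    HasDerivAt (szekeres L g g₁) (szekeres L g g₁ x * logFieldDeriv g g₁ g₂ x) x := by
  rw [szekeres_of_mem hx]
  refine (h.hasDerivAt_logField hx).exp.congr_of_eventuallyEq ?_
  filter_upwards [isOpen_Ioo.mem_nhds hx] with y hy
  exact szekeres_of_mem hy

/-- The logarithmic derivative may blow up like `x / disp g x`, but the field is at most a multiple
of `disp g x`, which cancels the denominator. The derivative therefore tends to `0` at the origin.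
-/
theorem abs_szekeres_deriv_le (h : ParabolicContraction C L g g₁ g₂) {x : ℝ} (hx : x ∈ Ioo 0 L) :
    |szekeres L g g₁ x * logFieldDeriv g g₁ g₂ x| ≤ C * Real.exp (C * C) ^ 3 * x := by
  have h1 : |logFieldDeriv g g₁ g₂ x| ≤ C * Real.exp (C * C) ^ 2 / disp g x * x := by
    simpa using h.abs_logFieldDeriv_add_sum_le hx 0
  have h2 := h.szekeres_le' hx
  have h3 := h.disp_pos hx
  have := h.C_pos
  have := hx.1
  rw [abs_mul, abs_of_nonneg (szekeres_nonneg x)]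
  calc _ ≤ (Real.exp (C * C) * disp g x) * (C * Real.exp (C * C) ^ 2 / disp g x * x) := by gcongr
    _ = _ := by field_simp

/-- At both endpoints the field is squeezed by a multiple of the displacement. This is the
continuous extension to the closed interval; differentiability at `L` is not claimed. -/
theorem continuousOn_szekeres (h : ParabolicContraction C L g g₁ g₂) :
    ContinuousOn (szekeres L g g₁) (Icc 0 L) := by
  have key : ∀ x ∈ Icc 0 L, disp g x = 0 → szekeres L g g₁ x = 0 →
      ContinuousWithinAt (szekeres L g g₁) (Icc 0 L) x := by
    intro x hx h0 h1
    have ht := (h.continuousOn_disp x hx).const_mul (Real.exp (C * C))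
    rw [ContinuousWithinAt, h0, mul_zero] at ht
    rw [ContinuousWithinAt, h1]
    refine squeeze_zero' (Eventually.of_forall fun y => szekeres_nonneg y) ?_ ht
    filter_upwards [self_mem_nhdsWithin] with y hy
    rcases eq_endpoints_or_mem_Ioo_of_mem_Icc hy with rfl | rfl | hy'
    · rw [szekeres_zero]
      exact mul_nonneg (Real.exp_pos _).le (h.disp_nonneg hy)
    · rw [szekeres_right]
      exact mul_nonneg (Real.exp_pos _).le (h.disp_nonneg hy)
    · exact h.szekeres_le' hy'
  intro x hx
  rcases eq_endpoints_or_mem_Ioo_of_mem_Icc hx with rfl | rfl | hx'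
  · exact key _ hx (by simp [disp, h.map_zero]) szekeres_zero
  · exact key _ hx (by simp [disp, h.map_right]) szekeres_right
  · exact (h.hasDerivAt_szekeres hx').continuousAt.continuousWithinAt

end ParabolicContraction

/-! ### Regularity at the repelling endpoint, and the time function of the field. -/

theorem exists_hasDerivAt_of_continuousOn_Ioo {u v : ℝ} {Y : ℝ → ℝ}
    (hY : ContinuousOn Y (Ioo u v)) : ∃ T : ℝ → ℝ, ∀ x ∈ Ioo u v, HasDerivAt T (Y x) x := by
  refine ⟨fun x => ∫ t in ((u + v) / 2)..x, Y t, fun x hx => ?_⟩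
  have huv : (u + v) / 2 ∈ Ioo u v := ⟨by linarith [hx.1, hx.2], by linarith [hx.1, hx.2]⟩
  have hsub : uIcc ((u + v) / 2) x ⊆ Ioo u v := ordConnected_Ioo.uIcc_subset huv hx
  refine intervalIntegral.integral_hasDerivAt_right ((hY.mono hsub).intervalIntegrable) ?_
    (hY.continuousAt (isOpen_Ioo.mem_nhds hx))
  exact hY.stronglyMeasurableAtFilter isOpen_Ioo x hx

namespace ParabolicContraction

variable {C L : ℝ} {g g₁ g₂ : ℝ → ℝ}

theorem disp_le_mul_sq (h : ParabolicContraction C L g g₁ g₂) {x : ℝ} (hx : x ∈ Ioo 0 L) :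
    disp g x ≤ C * x ^ 2 := by
  obtain ⟨ξ, hξ, he⟩ := exists_sub_eq_deriv_mul hx.1
    (h.continuousOn_disp.mono (Icc_subset_Icc le_rfl hx.2.le))
    (fun y hy => h.hasDerivAt_disp (Ioo_subset_Ioo le_rfl hx.2.le hy))
  have h0 : disp g 0 = 0 := by simp [disp, h.map_zero]
  rw [h0, sub_zero, sub_zero] at he
  rw [he]
  have h1 := h.abs_one_sub_deriv_le (x := ξ) ⟨hξ.1.le, (hξ.2.trans hx.2).le⟩
  have h2 := hx.1
  have h3 := h.C_pos
  calc (1 - g₁ ξ) * x ≤ (C * x) * x := by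
        gcongr
        refine (le_abs_self _).trans (h1.trans ?_)
        gcongr
        exact hξ.2.le
    _ = _ := by ring

theorem hasDerivWithinAt_szekeres (h : ParabolicContraction C L g g₁ g₂) {x : ℝ}
    (hx : x ∈ Ico 0 L) :
    HasDerivWithinAt (szekeres L g g₁) (szekeres L g g₁ x * logFieldDeriv g g₁ g₂ x)
      (Ico 0 L) x := by
  rcases hx.1.eq_or_lt with rfl | h0
  swap
  · exact (h.hasDerivAt_szekeres ⟨h0, hx.2⟩).hasDerivWithinAt
  rw [szekeres_zero, zero_mul]
  -- At `0` the derivative exists and is zero because the field, like the displacement, is of second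
  -- order there.
  have hO : szekeres L g g₁ =O[𝓝[Ico 0 L] 0] fun x => ‖x - 0‖ ^ 2 := by
    refine Asymptotics.IsBigO.of_bound (Real.exp (C * C) * C) ?_
    filter_upwards [self_mem_nhdsWithin] with y hy
    rw [sub_zero, norm_pow, norm_norm, Real.norm_of_nonneg (szekeres_nonneg y),
      Real.norm_of_nonneg hy.1]
    rcases hy.1.eq_or_lt with rfl | hy0
    · simp [szekeres_zero]
    · rw [mul_assoc]
      refine (h.szekeres_le' ⟨hy0, hy.2⟩).trans ?_
      gcongr
      exact h.disp_le_mul_sq ⟨hy0, hy.2⟩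
  have := hO.hasFDerivWithinAt (𝕜 := ℝ) hx one_lt_two
  simpa using this.hasDerivWithinAt

theorem contDiffOn_szekeres (h : ParabolicContraction C L g g₁ g₂) :
    ContDiffOn ℝ 1 (szekeres L g g₁) (Ico 0 L) := by
  rw [contDiffOn_one_iff_derivWithin (uniqueDiffOn_Ico 0 L)]
  refine ⟨fun x hx => (h.hasDerivWithinAt_szekeres hx).differentiableWithinAt, ?_⟩
  have : ContinuousOn (fun x => szekeres L g g₁ x * logFieldDeriv g g₁ g₂ x) (Ico 0 L) := by
    intro x hx
    rcases hx.1.eq_or_lt with rfl | h0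
    swap
    · have hx' : x ∈ Ioo 0 L := ⟨h0, hx.2⟩
      exact ((h.hasDerivAt_szekeres hx').continuousAt.mul
        (h.continuousOn_logFieldDeriv.continuousAt (isOpen_Ioo.mem_nhds hx'))).continuousWithinAt
    rw [ContinuousWithinAt, szekeres_zero, zero_mul]
    refine squeeze_zero_norm' (a := fun x => C * Real.exp (C * C) ^ 3 * x) ?_ ?_
    · filter_upwards [self_mem_nhdsWithin] with y hy
      rcases hy.1.eq_or_lt with rfl | hy0
      · simp [szekeres_zero]
      · exact h.abs_szekeres_deriv_le ⟨hy0, hy.2⟩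
    · refine Tendsto.mono_left ?_ nhdsWithin_le_nhds
      simpa using (continuous_const_mul (C * Real.exp (C * C) ^ 3)).tendsto (0 : ℝ)
  exact this.congr fun x hx =>
    (h.hasDerivWithinAt_szekeres hx).derivWithin (uniqueDiffOn_Ico 0 L x hx)

theorem szekeres_div_disp_mem (h : ParabolicContraction C L g g₁ g₂) {x : ℝ} (hx : x ∈ Ioo 0 L) :
    szekeres L g g₁ x / disp g x ∈ Icc (Real.exp (-(C * x))) (Real.exp (C * x)) :=
  ⟨(le_div_iff₀ (h.disp_pos hx)).2 (h.le_szekeres hx),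
    (div_le_iff₀ (h.disp_pos hx)).2 (h.szekeres_le hx)⟩

theorem Ioo_mem_nhdsGT_zero (h : ParabolicContraction C L g g₁ g₂) : Ioo 0 L ∈ 𝓝[>] (0 : ℝ) :=
  Ioo_mem_nhdsGT h.pos

theorem tendsto_iterate_nhdsGT (h : ParabolicContraction C L g g₁ g₂) {x : ℝ} (hx : x ∈ Ioo 0 L) :
    Tendsto (fun n => g^[n] x) atTop (𝓝[>] 0) :=
  tendsto_nhdsWithin_iff.2
    ⟨h.tendsto_iterate hx, Eventually.of_forall fun n => (h.iterate_mem hx n).1⟩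

theorem tendsto_szekeres_div_disp (h : ParabolicContraction C L g g₁ g₂) :
    Tendsto (fun x => szekeres L g g₁ x / disp g x) (𝓝[>] 0) (𝓝 1) := by
  have h1 : Tendsto (fun x => Real.exp (-(C * x))) (𝓝[>] 0) (𝓝 1) := by
    have : Continuous fun x => Real.exp (-(C * x)) := by fun_prop
    simpa using (this.tendsto 0).mono_left nhdsWithin_le_nhds
  have h2 : Tendsto (fun x => Real.exp (C * x)) (𝓝[>] 0) (𝓝 1) := by
    have : Continuous fun x => Real.exp (C * x) := by fun_prop
    simpa using (this.tendsto 0).mono_left nhdsWithin_le_nhds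
  refine tendsto_of_tendsto_of_tendsto_of_le_of_le' h1 h2 ?_ ?_ <;>
    filter_upwards [h.Ioo_mem_nhdsGT_zero] with x hx
  · exact (h.szekeres_div_disp_mem hx).1
  · exact (h.szekeres_div_disp_mem hx).2

theorem tendsto_szekeres_div_disp_iterate (h : ParabolicContraction C L g g₁ g₂) {x : ℝ}
    (hx : x ∈ Ioo 0 L) :
    Tendsto (fun n => szekeres L g g₁ (g^[n] x) / disp g (g^[n] x)) atTop (𝓝 1) :=
  h.tendsto_szekeres_div_disp.comp (h.tendsto_iterate_nhdsGT hx)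

theorem abs_szekeres_sub_le (h : ParabolicContraction C L g g₁ g₂) {x y : ℝ} (hx : x ∈ Ioo 0 L)
    (hy : y ∈ Ioo (g x) x) :
    |szekeres L g g₁ y - szekeres L g g₁ x| ≤ C * Real.exp (C * C) ^ 3 * x * disp g x := by
  have h1 := h.mapsTo hx
  have := abs_sub_le_of_abs_deriv_le (u := g x) (v := x) (K := C * Real.exp (C * C) ^ 3 * x)
    (h.continuousOn_szekeres.mono (Icc_subset_Icc h1.1.le hx.2.le))
    (fun z hz => h.hasDerivAt_szekeres (Ioo_subset_Ioo h1.1.le hx.2.le hz))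
    (fun z hz => ?_) (right_mem_Icc.2 (hy.1.trans hy.2).le) (Ioo_subset_Icc_self hy)
  · refine this.trans ?_
    have := hx.1
    have := h.C_pos
    gcongr
    rw [abs_sub_comm, abs_of_pos (sub_pos.2 hy.2)]
    simp only [disp]
    linarith [hy.1]
  · refine (h.abs_szekeres_deriv_le (Ioo_subset_Ioo h1.1.le hx.2.le hz)).trans ?_
    have := h.C_pos
    gcongr
    exact hz.2.le

/-- A time function of the Szekeres vector field. -/
theorem exists_time (h : ParabolicContraction C L g g₁ g₂) :
    ∃ T : ℝ → ℝ, (∀ x ∈ Ioo 0 L, HasDerivAt T (szekeres L g g₁ x)⁻¹ x) ∧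
      ∀ x ∈ Ioo 0 L, T x - T (g x) = 1 := by
  obtain ⟨T, hT⟩ := exists_hasDerivAt_of_continuousOn_Ioo
    ((h.continuousOn_szekeres.mono Ioo_subset_Icc_self).inv₀
      fun x hx => (szekeres_pos (g := g) (g₁ := g₁) hx).ne')
  replace hT : ∀ x ∈ Ioo 0 L, HasDerivAt T (szekeres L g g₁ x)⁻¹ x := hT
  refine ⟨T, hT, fun x hx => ?_⟩
  -- Invariance of the field makes the time needed to go from `g x` to `x` constant; its value is
  -- then read off in the limit along an orbit tending to `0`.
  have hd : ∀ x ∈ Ioo 0 L, HasDerivAt (fun x => T x - T (g x)) 0 x := by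
    intro x hx
    have hgx := h.mapsTo hx
    have e : (szekeres L g g₁ x)⁻¹ - (szekeres L g g₁ (g x))⁻¹ * g₁ x = 0 := by
      have := (h.deriv_pos (Ioo_subset_Icc_self hx)).ne'
      rw [h.szekeres_apply hx, mul_inv_rev, inv_mul_cancel_right₀ this, sub_self]
    rw [← e]
    exact (hT x hx).sub ((hT (g x) hgx).comp x (h.hasDerivAt x hx))
  have hconst : ∀ n, T (g^[n] x) - T (g (g^[n] x)) = T x - T (g x) := by
    intro n
    have hp := h.iterate_mem hx n
    have := abs_sub_le_of_abs_deriv_le (h := fun x => T x - T (g x)) (h' := fun _ => 0)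
      (u := g^[n] x) (v := x) (K := 0)
      (fun y hy => (hd y ⟨hp.1.trans_le hy.1,
        hy.2.trans_lt hx.2⟩).continuousAt.continuousWithinAt)
      (fun y hy => hd y (Ioo_subset_Ioo hp.1.le hx.2.le hy)) (by simp)
      (left_mem_Icc.2 (h.iterate_le_self hx n)) (right_mem_Icc.2 (h.iterate_le_self hx n))
    rw [zero_mul, abs_nonpos_iff, sub_eq_zero] at this
    exact this.symm
  have hξ : ∀ n, ∃ ξ ∈ Ioo (g (g^[n] x)) (g^[n] x),
      T x - T (g x) = (szekeres L g g₁ ξ / disp g (g^[n] x))⁻¹ := by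
    intro n
    have hp := h.iterate_mem hx n
    have hgp := h.mapsTo hp
    obtain ⟨ξ, hξ, he⟩ := exists_sub_eq_deriv_mul (h.lt_self _ hp)
      (fun y hy => (hT y ⟨hgp.1.trans_le hy.1, hy.2.trans_lt hp.2⟩).continuousAt.continuousWithinAt)
      (fun y hy => hT y (Ioo_subset_Ioo hgp.1.le hp.2.le hy))
    refine ⟨ξ, hξ, ?_⟩
    rw [← hconst n, he, inv_div, disp, div_eq_inv_mul]
  choose ξ hξm hξe using hξ
  -- Between `g y` and `y` the field varies by at most a constant times `y * disp g y`, so moving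
  -- from `g^[n] x` to `ξ n` does not change the limit.
  have hlim : Tendsto (fun n => szekeres L g g₁ (ξ n) / disp g (g^[n] x)) atTop (𝓝 1) := by
    have h1 := h.tendsto_szekeres_div_disp_iterate hx
    have h2 : Tendsto (fun n => szekeres L g g₁ (ξ n) / disp g (g^[n] x) -
        szekeres L g g₁ (g^[n] x) / disp g (g^[n] x)) atTop (𝓝 0) := by
      have ht := (h.tendsto_iterate hx).const_mul (C * Real.exp (C * C) ^ 3)
      rw [mul_zero] at ht
      refine squeeze_zero_norm (fun n => ?_) ht
      have hp := h.iterate_mem hx n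
      rw [← sub_div, norm_div, Real.norm_eq_abs, Real.norm_of_nonneg (h.disp_pos hp).le,
        div_le_iff₀ (h.disp_pos hp)]
      exact h.abs_szekeres_sub_le hp (hξm n)
    simpa using h2.add h1
  have hlim' := hlim.inv₀ one_ne_zero
  rw [inv_one] at hlim'
  exact tendsto_nhds_unique (tendsto_const_nhds.congr hξe) hlim'

end ParabolicContraction

/-! ### The time-one map of the Szekeres field, and uniqueness of the field. -/

/-- `F` is the inverse of `g` on `[0, L)`. -/
structure IsRightInverseOn (L : ℝ) (g F : ℝ → ℝ) : Prop where
  map_zero : F 0 = 0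
  mem : ∀ x ∈ Ioo 0 L, F x ∈ Ioo 0 L
  apply : ∀ x ∈ Ioo 0 L, g (F x) = x

namespace ParabolicContraction

variable {C L : ℝ} {g g₁ g₂ F : ℝ → ℝ}

theorem self_lt (h : ParabolicContraction C L g g₁ g₂) (hF : IsRightInverseOn L g F) {x : ℝ}
    (hx : x ∈ Ioo 0 L) : x < F x := by
  have := h.lt_self _ (hF.mem x hx)
  rwa [hF.apply x hx] at this

theorem rightInverse_apply (h : ParabolicContraction C L g g₁ g₂) (hF : IsRightInverseOn L g F)
    {x : ℝ} (hx : x ∈ Ioo 0 L) : F (g x) = x :=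
  h.strictMonoOn.injOn (Ioo_subset_Icc_self (hF.mem _ (h.mapsTo hx))) (Ioo_subset_Icc_self hx)
    (hF.apply _ (h.mapsTo hx))

theorem isTimeOneMap_szekeres (h : ParabolicContraction C L g g₁ g₂)
    (hF : IsRightInverseOn L g F) : IsTimeOneMap (szekeres L g g₁) (Ico 0 L) F := by
  intro x hx
  rcases hx.1.eq_or_lt with rfl | h0
  · refine ⟨fun _ => 0, rfl, hF.map_zero.symm, fun _ _ => hx, fun t _ => ?_⟩
    simpa only [szekeres_zero] using hasDerivWithinAt_const t (Icc 0 1) (0 : ℝ)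
  replace hx : x ∈ Ioo 0 L := ⟨h0, hx.2⟩
  obtain ⟨T, hT, hT1⟩ := h.exists_time
  have hFx := hF.mem x hx
  have hFF := hF.mem _ hFx
  have hgx := h.mapsTo hx
  have e1 : T (F x) = T x + 1 := by
    have := hT1 _ hFx
    rw [hF.apply x hx] at this
    linarith
  have e2 : T (F (F x)) = T x + 2 := by
    have := hT1 _ hFF
    rw [hF.apply _ hFx] at this
    linarith
  have e0 : T (g x) = T x - 1 := by linarith [hT1 x hx]
  -- The window from `g x` to `F (F x)` covers the times from `-1` to `2`, so every time in `[0, 1]`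
  -- is interior and two-sided derivatives can be used.
  set u := g x
  set v := F (F x)
  have huv : u ≤ v := ((h.lt_self x hx).trans ((h.self_lt hF hx).trans (h.self_lt hF hFx))).le
  have hsub : Icc u v ⊆ Ioo 0 L := fun y hy => ⟨hgx.1.trans_le hy.1, hy.2.trans_lt hFF.2⟩
  have hc : ContinuousOn T (Icc u v) := fun y hy =>
    (hT y (hsub hy)).continuousAt.continuousWithinAt
  have hsurj : ∀ t ∈ Icc (T x - 1) (T x + 2), ∃ y ∈ Icc u v, T y = t := by
    intro t ht
    rw [← e0, ← e2] at ht
    exact intermediate_value_Icc huv hc ht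
  have hM : ∀ y ∈ Ioo 0 L, szekeres L g g₁ y ≤ Real.exp (C * C) * C := fun y hy =>
    (h.szekeres_le' hy).trans (by
      gcongr
      exact (h.disp_le_self hy).trans (hy.2.le.trans h.le))
  set M := Real.exp (C * C) * C
  have hMpos : 0 < M := mul_pos (Real.exp_pos _) h.C_pos
  -- An upper bound on the field makes the inverse of `T` Lipschitz. This gives both its uniqueness
  -- and the continuity that the inverse derivative rule requires.
  have hexp : ∀ y ∈ Icc u v, ∀ z ∈ Icc u v, |y - z| ≤ M * |T y - T z| := by
    intro y hy z hz
    wlog hyz : z < y generalizing y z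
    · rcases (not_lt.1 hyz).eq_or_lt with rfl | hlt
      · simp
      · rw [abs_sub_comm, abs_sub_comm (T y)]
        exact this z hz y hy hlt
    obtain ⟨ξ, hξ, he⟩ := exists_sub_eq_deriv_mul hyz (hc.mono (Icc_subset_Icc hz.1 hy.2))
      (fun w hw => hT w (hsub ⟨hz.1.trans hw.1.le, hw.2.le.trans hy.2⟩))
    have hξ' : ξ ∈ Ioo 0 L := hsub ⟨hz.1.trans hξ.1.le, hξ.2.le.trans hy.2⟩
    have hp := szekeres_pos (g := g) (g₁ := g₁) hξ'
    have e : y - z = szekeres L g g₁ ξ * (T y - T z) := by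
      rw [he]
      field_simp
    rw [e, abs_mul, abs_of_pos hp]
    gcongr
    exact hM ξ hξ'
  have hinj : ∀ y ∈ Icc u v, ∀ z ∈ Icc u v, T y = T z → y = z := by
    intro y hy z hz hyz
    have := hexp y hy z hz
    rw [hyz, sub_self, abs_zero, mul_zero, abs_nonpos_iff, sub_eq_zero] at this
    exact this
  have hex : ∀ t : ℝ, ∃ y, t ∈ Icc (-1 : ℝ) 2 → y ∈ Icc u v ∧ T y = T x + t := by
    intro t
    by_cases ht : t ∈ Icc (-1 : ℝ) 2
    · obtain ⟨y, hy, hyt⟩ := hsurj (T x + t) ⟨by linarith [ht.1], by linarith [ht.2]⟩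
      exact ⟨y, fun _ => ⟨hy, hyt⟩⟩
    · exact ⟨0, fun h' => (ht h').elim⟩
  choose φ hφ using hex
  have hxm : x ∈ Icc u v :=
    ⟨(h.lt_self x hx).le, ((h.self_lt hF hx).trans (h.self_lt hF hFx)).le⟩
  have hFm : F x ∈ Icc u v :=
    ⟨((h.lt_self x hx).trans (h.self_lt hF hx)).le, (h.self_lt hF hFx).le⟩
  refine ⟨φ, ?_, ?_, ?_, ?_⟩
  · obtain ⟨h1, h2⟩ := hφ 0 (by norm_num)
    exact hinj _ h1 _ hxm (by rw [h2, add_zero])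
  · obtain ⟨h1, h2⟩ := hφ 1 (by norm_num)
    exact hinj _ h1 _ hFm (by rw [h2, e1])
  · intro t ht
    exact Ioo_subset_Ico_self (hsub (hφ t ⟨by linarith [ht.1], by linarith [ht.2]⟩).1)
  · intro t ht
    have ht' : t ∈ Ioo (-1 : ℝ) 2 := ⟨by linarith [ht.1], by linarith [ht.2]⟩
    have hnear : ∀ᶠ s in 𝓝 t, s ∈ Ioo (-1 : ℝ) 2 := isOpen_Ioo.mem_nhds ht'
    obtain ⟨h1, h2⟩ := hφ t (Ioo_subset_Icc_self ht')
    have hcont : ContinuousAt φ t := by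
      rw [ContinuousAt, tendsto_iff_dist_tendsto_zero]
      have hlim : Tendsto (fun s => M * |s - t|) (𝓝 t) (𝓝 0) := by
        have : Continuous fun s : ℝ => M * |s - t| := by fun_prop
        simpa using this.tendsto t
      refine squeeze_zero' (Eventually.of_forall fun _ => dist_nonneg) ?_ hlim
      filter_upwards [hnear] with s hs
      obtain ⟨h3, h4⟩ := hφ s (Ioo_subset_Icc_self hs)
      have := hexp _ h3 _ h1
      rwa [h2, h4, add_sub_add_left_eq_sub] at this
    have hpos := szekeres_pos (g := g) (g₁ := g₁) (hsub h1)
    have hder : HasDerivAt (fun y => T y - T x) (szekeres L g g₁ (φ t))⁻¹ (φ t) :=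
      (hT _ (hsub h1)).sub_const _
    have := hder.of_local_left_inverse hcont (inv_ne_zero hpos.ne') (by
      filter_upwards [hnear] with s hs
      rw [(hφ s (Ioo_subset_Icc_self hs)).2]
      ring)
    rw [inv_inv] at this
    exact this.hasDerivWithinAt

variable {Y : ℝ → ℝ}

/-- An integral curve from `0` stays in `[0, L)` and is again at `0` at time `1`. Its slope is
nonnegative when it leaves and nonpositive when it arrives, and both slopes equal the field at `0`.
-/
theorem timeOne_apply_zero (hL : 0 < L) (hF : F 0 = 0)
    (hY : IsTimeOneMap Y (Ico 0 L) F) : Y 0 = 0 := by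
  obtain ⟨φ, h0, h1, hm, hd⟩ := hY 0 ⟨le_rfl, hL⟩
  rw [hF] at h1
  apply le_antisymm
  · have := hd 1 (by simp)
    rw [h1] at this
    have hs := (hasDerivWithinAt_iff_tendsto_slope' (by simp)).1 (this.mono Ioo_subset_Icc_self)
    rw [nhdsWithin_Ioo_eq_nhdsLT one_pos] at hs
    refine le_of_tendsto hs ?_
    filter_upwards [Ioo_mem_nhdsLT (zero_lt_one (α := ℝ))] with t ht
    rw [slope_def_field, h1]
    exact div_nonpos_of_nonneg_of_nonpos (by linarith [(hm t (Ioo_subset_Icc_self ht)).1])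
      (by linarith [ht.2])
  · have := hd 0 (by simp)
    rw [h0] at this
    have hs := (hasDerivWithinAt_iff_tendsto_slope' (by simp)).1 (this.mono Ioo_subset_Icc_self)
    rw [nhdsWithin_Ioo_eq_nhdsGT one_pos] at hs
    refine ge_of_tendsto hs ?_
    filter_upwards [Ioo_mem_nhdsGT (zero_lt_one (α := ℝ))] with t ht
    rw [slope_def_field, h0]
    exact div_nonneg (by linarith [(hm t (Ioo_subset_Icc_self ht)).1]) (by linarith [ht.1])

theorem hasDerivAt_of_contDiffOn (hC : ContDiffOn ℝ 1 Y (Ico 0 L)) {x : ℝ} (hx : x ∈ Ioo 0 L) :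
    HasDerivAt Y (derivWithin Y (Ico 0 L) x) x :=
  ((hC.differentiableOn one_ne_zero) x (Ioo_subset_Ico_self hx)).hasDerivWithinAt.hasDerivAt
    (Ico_mem_nhds hx.1 hx.2)

theorem continuousOn_derivWithin_of_contDiffOn (hC : ContDiffOn ℝ 1 Y (Ico 0 L)) :
    ContinuousOn (derivWithin Y (Ico 0 L)) (Ico 0 L) :=
  ((contDiffOn_one_iff_derivWithin (uniqueDiffOn_Ico 0 L)).1 hC).2

theorem exists_abs_sub_le (hC : ContDiffOn ℝ 1 Y (Ico 0 L)) {M : ℝ} (hM : M < L) :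
    ∃ K, ∀ s ∈ Icc 0 M, ∀ t ∈ Icc 0 M, |Y t - Y s| ≤ K * |t - s| := by
  have hsub : Icc 0 M ⊆ Ico 0 L := fun y hy => ⟨hy.1, hy.2.trans_lt hM⟩
  obtain ⟨K, hK⟩ := isCompact_Icc.exists_bound_of_continuousOn
    ((continuousOn_derivWithin_of_contDiffOn hC).mono hsub)
  refine ⟨K, fun s hs t ht => abs_sub_le_of_abs_deriv_le (hC.continuousOn.mono hsub)
    (fun x hx => hasDerivAt_of_contDiffOn hC ⟨hx.1, hx.2.trans hM⟩)
    (fun x hx => hK x (Ioo_subset_Icc_self hx)) hs ht⟩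

/-- By Grönwall an integral curve starting at a zero of the field is constant, whereas `F` moves
every interior point. -/
theorem timeOne_ne_zero (h : ParabolicContraction C L g g₁ g₂) (hF : IsRightInverseOn L g F)
    (hC : ContDiffOn ℝ 1 Y (Ico 0 L)) (hY : IsTimeOneMap Y (Ico 0 L) F) {x : ℝ}
    (hx : x ∈ Ioo 0 L) : Y x ≠ 0 := by
  intro hYx
  obtain ⟨φ, h0, h1, hm, hd⟩ := hY x (Ioo_subset_Ico_self hx)
  have hφ : ContinuousOn φ (Icc 0 1) := fun t ht => (hd t ht).continuousWithinAt
  -- Nothing is known about `Y` near `L`; the maximum of the curve confines it to a compact interval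
  -- on which `Y` is Lipschitz.
  obtain ⟨t₀, ht₀, hmax⟩ := isCompact_Icc.exists_isMaxOn (nonempty_Icc.2 zero_le_one) hφ
  obtain ⟨K, hK⟩ := exists_abs_sub_le hC (hm t₀ ht₀).2
  have hr : ∀ t ∈ Icc (0 : ℝ) 1, φ t ∈ Icc 0 (φ t₀) := fun t ht => ⟨(hm t ht).1, hmax ht⟩
  have := eq_zero_of_abs_deriv_le_mul_abs_self_of_eq_zero_right (f := fun t => φ t - x)
    (f' := fun t => Y (φ t)) (K := K) (hφ.sub continuousOn_const)
    (fun t ht => ((hd t (Ico_subset_Icc_self ht)).sub_const x).mono_of_mem_nhdsWithin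
      (Icc_mem_nhdsGE_of_mem ht)) (by simp [h0])
    (fun t ht => by
      have := hK x (h0 ▸ hr 0 (by simp)) (φ t) (hr t (Ico_subset_Icc_self ht))
      rwa [hYx, sub_zero] at this) 1 (by simp)
  rw [h1, sub_eq_zero] at this
  exact (h.self_lt hF hx).ne' this

/-- Without interior zeros the field has constant sign, and a nonpositive field could not carry `x`
to the larger point `F x`. -/
theorem timeOne_pos (h : ParabolicContraction C L g g₁ g₂) (hF : IsRightInverseOn L g F)
    (hC : ContDiffOn ℝ 1 Y (Ico 0 L)) (hY : IsTimeOneMap Y (Ico 0 L) F) {x : ℝ}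
    (hx : x ∈ Ioo 0 L) : 0 < Y x := by
  by_contra hneg
  have hneg' : Y x < 0 := lt_of_le_of_ne (not_lt.1 hneg) (h.timeOne_ne_zero hF hC hY hx)
  have hall : ∀ z ∈ Ico 0 L, Y z ≤ 0 := by
    intro z hz
    by_contra hz'
    rw [not_le] at hz'
    have hz0 : z ∈ Ioo 0 L := by
      refine ⟨lt_of_le_of_ne hz.1 ?_, hz.2⟩
      rintro rfl
      rw [timeOne_apply_zero h.pos hF.map_zero hY] at hz'
      exact lt_irrefl _ hz'
    obtain ⟨w, hw, hw0⟩ := isPreconnected_Ioo.intermediate_value hx hz0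
      (hC.continuousOn.mono Ioo_subset_Ico_self) ⟨hneg'.le, hz'.le⟩
    exact h.timeOne_ne_zero hF hC hY hw hw0
  obtain ⟨φ, h0, h1, hm, hd⟩ := hY x (Ioo_subset_Ico_self hx)
  obtain ⟨s, hs, he⟩ := exists_sub_eq_deriv_mul (h := φ) (h' := fun t => Y (φ t)) zero_lt_one
    (fun t ht => (hd t ht).continuousWithinAt)
    (fun t ht => (hd t (Ioo_subset_Icc_self ht)).hasDerivAt (Icc_mem_nhds ht.1 ht.2))
  rw [h0, h1] at he
  have := hall _ (hm s (Ioo_subset_Icc_self hs))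
  have := h.self_lt hF hx
  linarith

/-- A time function of a vector field with time-one map `F`. -/
theorem exists_time_of_isTimeOneMap (h : ParabolicContraction C L g g₁ g₂)
    (hF : IsRightInverseOn L g F) (hC : ContDiffOn ℝ 1 Y (Ico 0 L))
    (hY : IsTimeOneMap Y (Ico 0 L) F) :
    ∃ T : ℝ → ℝ, (∀ x ∈ Ioo 0 L, HasDerivAt T (Y x)⁻¹ x) ∧ ∀ x ∈ Ioo 0 L, T x - T (g x) = 1 := by
  obtain ⟨T, hT⟩ := exists_hasDerivAt_of_continuousOn_Ioo
    ((hC.continuousOn.mono Ioo_subset_Ico_self).inv₀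
      fun x hx => h.timeOne_ne_zero hF hC hY hx)
  replace hT : ∀ x ∈ Ioo 0 L, HasDerivAt T (Y x)⁻¹ x := hT
  refine ⟨T, hT, fun x hx => ?_⟩
  have hgx := h.mapsTo hx
  obtain ⟨φ, h0, h1, hm, hd⟩ := hY (g x) (Ioo_subset_Ico_self hgx)
  rw [h.rightInverse_apply hF hx] at h1
  have hφ : ContinuousOn φ (Icc 0 1) := fun t ht => (hd t ht).continuousWithinAt
  have hd' : ∀ t ∈ Ioo (0 : ℝ) 1, HasDerivAt φ (Y (φ t)) t := fun t ht =>
    (hd t (Ioo_subset_Icc_self ht)).hasDerivAt (Icc_mem_nhds ht.1 ht.2)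
  have hnn : ∀ z ∈ Ico 0 L, 0 ≤ Y z := by
    intro z hz
    rcases hz.1.eq_or_lt with rfl | hz0
    · exact (timeOne_apply_zero h.pos hF.map_zero hY).ge
    · exact (h.timeOne_pos hF hC hY ⟨hz0, hz.2⟩).le
  -- A nonnegative field makes the curve nondecreasing, so it stays above `g x` and away from `0`,
  -- where `T` is not controlled.
  have hmono : ∀ t ∈ Icc (0 : ℝ) 1, φ t ∈ Ioo 0 L := by
    intro t ht
    refine ⟨?_, (hm t ht).2⟩
    rcases ht.1.eq_or_lt with rfl | ht0
    · rw [h0]; exact hgx.1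
    obtain ⟨s, hs, he⟩ := exists_sub_eq_deriv_mul ht0 (hφ.mono (Icc_subset_Icc le_rfl ht.2))
      (fun s hs => hd' s (Ioo_subset_Ioo le_rfl ht.2 hs))
    have h3 := hnn _ (hm s ⟨hs.1.le, hs.2.le.trans ht.2⟩)
    have h4 : 0 ≤ Y (φ s) * (t - 0) := mul_nonneg h3 (by linarith)
    rw [h0] at he
    linarith [hgx.1]
  obtain ⟨s, -, he⟩ := exists_sub_eq_deriv_mul (h := fun t => T (φ t)) (h' := fun _ => 1)
    zero_lt_one
    (fun t ht => ((hT _ (hmono t ht)).continuousAt.comp_continuousWithinAt (hφ t ht)))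
    (fun t ht => by
      have hp := hmono t (Ioo_subset_Icc_self ht)
      have := (hT _ hp).comp t (hd' t ht)
      rwa [inv_mul_cancel₀ (h.timeOne_ne_zero hF hC hY hp)] at this)
  rw [h0, h1] at he
  linarith

/-- This is the derivative of the identity `T x - T (g x) = 1`. -/
theorem timeOne_apply (h : ParabolicContraction C L g g₁ g₂)
    (hF : IsRightInverseOn L g F) (hC : ContDiffOn ℝ 1 Y (Ico 0 L))
    (hY : IsTimeOneMap Y (Ico 0 L) F) {x : ℝ} (hx : x ∈ Ioo 0 L) : Y (g x) = g₁ x * Y x := by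
  obtain ⟨T, hT, hT1⟩ := h.exists_time_of_isTimeOneMap hF hC hY
  have hgx := h.mapsTo hx
  have h1 : HasDerivAt (fun x => T x - T (g x)) ((Y x)⁻¹ - (Y (g x))⁻¹ * g₁ x) x :=
    (hT x hx).sub ((hT (g x) hgx).comp x (h.hasDerivAt x hx))
  have h2 : HasDerivAt (fun x => T x - T (g x)) 0 x := by
    refine (hasDerivAt_const x (1 : ℝ)).congr_of_eventuallyEq ?_
    filter_upwards [isOpen_Ioo.mem_nhds hx] with y hy using hT1 y hy
  have h3 := h1.unique h2
  have := h.timeOne_ne_zero hF hC hY hx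
  have := h.timeOne_ne_zero hF hC hY hgx
  field_simp at h3
  linarith

theorem timeOne_div_iterate (h : ParabolicContraction C L g g₁ g₂)
    (hF : IsRightInverseOn L g F) (hC : ContDiffOn ℝ 1 Y (Ico 0 L))
    (hY : IsTimeOneMap Y (Ico 0 L) F) {x : ℝ} (hx : x ∈ Ioo 0 L) (n : ℕ) :
    Y (g^[n] x) / szekeres L g g₁ (g^[n] x) = Y x / szekeres L g g₁ x := by
  induction n with
  | zero => rfl
  | succ n ih =>
    have hp := h.iterate_mem hx n
    rw [Function.iterate_succ_apply', h.timeOne_apply hF hC hY hp, h.szekeres_apply hp,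
      mul_div_mul_left _ _ (h.deriv_pos (Ioo_subset_Icc_self hp)).ne', ih]

/-- As the transit time is `1`, the field equals `disp g (g^[n] x)` at some point `ξ n` of the
`n`-th fundamental interval. Once the derivative of `Y` is known to vanish at `0`, the variation of
`Y` over that interval is negligible compared with its length. -/
theorem tendsto_timeOne_div_disp (h : ParabolicContraction C L g g₁ g₂)
    (hF : IsRightInverseOn L g F) (hC : ContDiffOn ℝ 1 Y (Ico 0 L))
    (hY : IsTimeOneMap Y (Ico 0 L) F) {x : ℝ} (hx : x ∈ Ioo 0 L) :
    Tendsto (fun n => Y (g^[n] x) / disp g (g^[n] x)) atTop (𝓝 1) := by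
  obtain ⟨T, hT, hT1⟩ := h.exists_time_of_isTimeOneMap hF hC hY
  have hY0 := timeOne_apply_zero h.pos hF.map_zero hY
  have hξ : ∀ n, ∃ ξ ∈ Ioo (g (g^[n] x)) (g^[n] x), Y ξ = disp g (g^[n] x) := by
    intro n
    have hp := h.iterate_mem hx n
    have hgp := h.mapsTo hp
    obtain ⟨ξ, hξ, he⟩ := exists_sub_eq_deriv_mul (h.lt_self _ hp)
      (fun y hy => (hT y ⟨hgp.1.trans_le hy.1, hy.2.trans_lt hp.2⟩).continuousAt.continuousWithinAt)
      (fun y hy => hT y (Ioo_subset_Ioo hgp.1.le hp.2.le hy))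
    refine ⟨ξ, hξ, ?_⟩
    have := h.timeOne_ne_zero hF hC hY (Ioo_subset_Ioo hgp.1.le hp.2.le hξ)
    rw [hT1 _ hp] at he
    field_simp at he
    exact he
  choose ξ hξm hξe using hξ
  have ht := h.tendsto_iterate hx
  have hξpos : ∀ n, 0 < ξ n := fun n => (h.mapsTo (h.iterate_mem hx n)).1.trans (hξm n).1
  have hξL : ∀ n, ξ n < L := fun n => (hξm n).2.trans (h.iterate_mem hx n).2
  have hξ0 : Tendsto ξ atTop (𝓝 0) :=
    squeeze_zero (fun n => (hξpos n).le) (fun n => (hξm n).2.le) ht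
  have hmem0 : (0 : ℝ) ∈ Ico 0 L := ⟨le_rfl, h.pos⟩
  -- the derivative of `Y` vanishes at the origin
  have hder0 : derivWithin Y (Ico 0 L) 0 = 0 := by
    have h1 : HasDerivWithinAt Y (derivWithin Y (Ico 0 L) 0) (Ioo 0 L) 0 :=
      ((hC.differentiableOn one_ne_zero) 0 hmem0).hasDerivWithinAt.mono Ioo_subset_Ico_self
    have h2 := (hasDerivWithinAt_iff_tendsto_slope' (by simp)).1 h1
    have h3 : Tendsto ξ atTop (𝓝[Ioo 0 L] 0) :=
      tendsto_nhdsWithin_iff.2 ⟨hξ0, Eventually.of_forall fun n => ⟨hξpos n, hξL n⟩⟩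
    have h4 := h2.comp h3
    refine tendsto_nhds_unique h4 ?_
    -- The slope of `Y` at `ξ n` is `disp g (g^[n] x) / ξ n`. The numerator is at most `C * (g^[n]
    -- x) ^ 2`, and eventually `ξ n` is at least `g^[n] x / 2`.
    have h5 : Tendsto (fun n => 2 * C * g^[n] x) atTop (𝓝 0) := by
      simpa using ht.const_mul (2 * C)
    have hCp := h.C_pos
    refine squeeze_zero' (Eventually.of_forall fun n => ?_) ?_ h5
    · simp only [Function.comp, slope_def_field, hY0, sub_zero, hξe]
      exact div_nonneg (h.disp_pos (h.iterate_mem hx n)).le (hξpos n).le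
    · filter_upwards [ht.eventually (gt_mem_nhds (show 0 < 1 / (2 * C) by positivity))] with n hn
      have hp := h.iterate_mem hx n
      simp only [Function.comp, slope_def_field, hY0, sub_zero, hξe]
      rw [div_le_iff₀ (hξpos n)]
      have h6 := h.disp_le_mul_sq hp
      have h7 : g^[n] x - C * (g^[n] x) ^ 2 ≤ ξ n := by
        have h8 := (hξm n).1
        have h9 : disp g (g^[n] x) = g^[n] x - g (g^[n] x) := rfl
        linarith
      have h8 : C * g^[n] x < 1 / 2 := by
        rw [lt_div_iff₀ (by positivity)] at hn
        linarith
      have h9 : g^[n] x / 2 ≤ ξ n := by nlinarith [hp.1]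
      have h10 : 0 ≤ C * g^[n] x := mul_nonneg hCp.le hp.1.le
      nlinarith
  have hcd := continuousOn_derivWithin_of_contDiffOn hC 0 hmem0
  rw [ContinuousWithinAt, hder0] at hcd
  rw [Metric.tendsto_atTop]
  intro ε hε
  have hev : ∀ᶠ y in 𝓝[Ico 0 L] 0, |derivWithin Y (Ico 0 L) y| < ε / 2 := by
    have := hcd.abs
    rw [abs_zero] at this
    exact this.eventually (gt_mem_nhds (by positivity))
  rw [nhdsWithin_Ico_eq_nhdsGE h.pos, eventually_iff, mem_nhdsGE_iff_exists_Ico_subset] at hev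
  obtain ⟨δ, hδ, hδs⟩ := hev
  obtain ⟨N, hN⟩ := eventually_atTop.1 (ht.eventually (gt_mem_nhds (mem_Ioi.1 hδ)))
  refine ⟨N, fun n hn => ?_⟩
  have hp := h.iterate_mem hx n
  have hgp := h.mapsTo hp
  have hdp := h.disp_pos hp
  have hb := abs_sub_le_of_abs_deriv_le (u := g (g^[n] x)) (v := g^[n] x) (K := ε / 2)
    (hC.continuousOn.mono fun y hy => ⟨hgp.1.le.trans hy.1, hy.2.trans_lt hp.2⟩)
    (fun y hy => hasDerivAt_of_contDiffOn hC (Ioo_subset_Ioo hgp.1.le hp.2.le hy))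
    (fun y hy => (hδs ⟨hgp.1.le.trans hy.1.le, hy.2.trans (hN n hn)⟩).le)
    (Ioo_subset_Icc_self (hξm n)) (right_mem_Icc.2 (h.lt_self _ hp).le)
  rw [Real.dist_eq, div_sub_one hdp.ne', abs_div, abs_of_pos hdp, div_lt_iff₀ hdp, ← hξe n]
  refine hb.trans_lt ?_
  rw [hξe, abs_of_pos (sub_pos.2 (hξm n).2)]
  have : g^[n] x - ξ n ≤ disp g (g^[n] x) := sub_le_sub_left (hξm n).1.le _
  have : ε / 2 * (g^[n] x - ξ n) ≤ ε / 2 * disp g (g^[n] x) := by gcongr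
  nlinarith [mul_pos hε hdp]

/-- The `C¹` vector field on `[0, L)` with a given time-one map is unique. -/
theorem eqOn_szekeres (h : ParabolicContraction C L g g₁ g₂)
    (hF : IsRightInverseOn L g F) (hC : ContDiffOn ℝ 1 Y (Ico 0 L))
    (hY : IsTimeOneMap Y (Ico 0 L) F) : EqOn Y (szekeres L g g₁) (Ico 0 L) := by
  intro x hx
  rcases hx.1.eq_or_lt with rfl | h0
  · rw [timeOne_apply_zero h.pos hF.map_zero hY, szekeres_zero]
  have hx' : x ∈ Ioo 0 L := ⟨h0, hx.2⟩
  have h1 := (h.tendsto_timeOne_div_disp hF hC hY hx').div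
    (h.tendsto_szekeres_div_disp_iterate hx') one_ne_zero
  have h2 : Y x / szekeres L g g₁ x = 1 := by
    refine tendsto_nhds_unique (tendsto_const_nhds.congr fun n => ?_) (by simpa using h1)
    have hp := h.iterate_mem hx' n
    rw [← h.timeOne_div_iterate hF hC hY hx' n, Pi.div_apply,
      div_div_div_cancel_right₀ (h.disp_pos hp).ne']
  exact (div_eq_one_iff_eq (szekeres_pos hx').ne').1 h2

end ParabolicContraction

/-! ### Quadratic growth on one component, through the increments of `1 / √disp`. -/

/-- A nonnegative function whose derivative `h₁` is Lipschitz satisfies `h₁ ^ 2 ≤ 4 * K * h`, as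
long as there is room enough in the interval. -/
theorem sq_deriv_le {h h₁ : ℝ → ℝ} {u v K x : ℝ} (hK : 0 < K) (hc : ContinuousOn h (Icc u v))
    (hd : ∀ x ∈ Ioo u v, HasDerivAt h (h₁ x) x)
    (hLip : ∀ s ∈ Icc u v, ∀ t ∈ Icc u v, |h₁ t - h₁ s| ≤ K * |t - s|)
    (hnn : ∀ x ∈ Icc u v, 0 ≤ h x) (hx : x ∈ Icc u v)
    (hl : h₁ x ≤ K * (x - u)) (hr : -h₁ x ≤ K * (v - x)) : h₁ x ^ 2 ≤ 4 * K * h x := by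
  rcases lt_trichotomy (h₁ x) 0 with hp | hp | hp
  -- Moving a distance `s` in the direction of decrease keeps the slope at least half its initial
  -- size, so the function drops by at least `K * s ^ 2`. Nonnegativity at the new point gives the
  -- bound, and the room hypothesis keeps that point in the interval.
  · set s := -h₁ x / (2 * K) with hs
    have hs0 : 0 < s := div_pos (by linarith) (by linarith)
    have hsK : -h₁ x = 2 * K * s := by rw [hs]; field_simp
    have hsv : x + s ≤ v := by
      have : K * (2 * s) ≤ K * (v - x) := by linarith
      have := le_of_mul_le_mul_left this hK
      linarith
    obtain ⟨ξ, hξ, he⟩ := exists_sub_eq_deriv_mul (show x < x + s by linarith)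
      (hc.mono (Icc_subset_Icc hx.1 hsv)) (fun y hy => hd y (Ioo_subset_Ioo hx.1 hsv hy))
    have h2 := (abs_le.1 (hLip x hx ξ ⟨hx.1.trans hξ.1.le, hξ.2.le.trans hsv⟩)).2
    rw [abs_of_pos (by linarith [hξ.1])] at h2
    have h3 : K * (ξ - x) ≤ K * s := by gcongr; linarith [hξ.2]
    have h4 := hnn (x + s) ⟨by linarith [hx.1], hsv⟩
    have h5 : h₁ ξ * s ≤ (-(K * s)) * s := by gcongr; linarith
    have h6 : h₁ x ^ 2 = 4 * K * (K * s * s) := by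
      rw [show h₁ x = -(2 * K * s) by linarith]; ring
    rw [h6]
    have : K * s * s ≤ h x := by nlinarith
    gcongr
  · rw [hp, zero_pow two_ne_zero]
    have := hnn x hx
    positivity
  · set s := h₁ x / (2 * K) with hs
    have hs0 : 0 < s := div_pos (by linarith) (by linarith)
    have hsK : h₁ x = 2 * K * s := by rw [hs]; field_simp
    have hsv : u ≤ x - s := by
      have : K * (2 * s) ≤ K * (x - u) := by linarith
      have := le_of_mul_le_mul_left this hK
      linarith
    obtain ⟨ξ, hξ, he⟩ := exists_sub_eq_deriv_mul (show x - s < x by linarith)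
      (hc.mono (Icc_subset_Icc hsv hx.2)) (fun y hy => hd y (Ioo_subset_Ioo hsv hx.2 hy))
    have h2 := (abs_le.1 (hLip ξ ⟨hsv.trans hξ.1.le, hξ.2.le.trans hx.2⟩ x hx)).2
    rw [abs_of_pos (by linarith [hξ.2])] at h2
    have h3 : K * (x - ξ) ≤ K * s := by gcongr; linarith [hξ.1]
    have h4 := hnn (x - s) ⟨hsv, by linarith [hx.2]⟩
    have h5 : (K * s) * s ≤ h₁ ξ * s := by gcongr; linarith
    have h6 : h₁ x ^ 2 = 4 * K * (K * s * s) := by rw [hsK]; ring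
    rw [h6]
    have : K * s * s ≤ h x := by nlinarith
    gcongr

namespace ParabolicContraction

variable {C L : ℝ} {g g₁ g₂ : ℝ → ℝ}

/-- Parabolicity at both endpoints provides exactly the room needed on either side, so the constant
does not depend on the length of the component. -/
theorem sq_one_sub_deriv_le (h : ParabolicContraction C L g g₁ g₂) {x : ℝ} (hx : x ∈ Icc 0 L) :
    (1 - g₁ x) ^ 2 ≤ 4 * C * disp g x := by
  refine sq_deriv_le (h₁ := fun x => 1 - g₁ x) h.C_pos h.continuousOn_disp
    (fun y hy => h.hasDerivAt_disp hy) ?_ (fun y hy => h.disp_nonneg hy) hx ?_ ?_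
  · intro s hs t ht
    have := h.abs_deriv_sub_le ht hs
    rwa [abs_sub_comm s, ← sub_sub_sub_cancel_left _ _ (1 : ℝ)] at this
  · rw [sub_zero]
    exact (le_abs_self _).trans (h.abs_one_sub_deriv_le hx)
  · have := h.abs_deriv_sub_le hx (right_mem_Icc.2 h.pos.le)
    rw [h.deriv_right, abs_of_nonneg (sub_nonneg.2 hx.2)] at this
    exact (neg_le_abs _).trans this

theorem tendsto_nhdsGT_of_continuousOn {φ : ℝ → ℝ} (hL : 0 < L) (hφ : ContinuousOn φ (Icc 0 L)) :
    Tendsto φ (𝓝[>] 0) (𝓝 (φ 0)) := by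
  rw [← nhdsWithin_Ioo_eq_nhdsGT hL]
  exact (hφ 0 (left_mem_Icc.2 hL.le)).mono_left (nhdsWithin_mono _ Ioo_subset_Icc_self)

theorem tendsto_disp (h : ParabolicContraction C L g g₁ g₂) :
    Tendsto (disp g) (𝓝[>] 0) (𝓝 0) := by
  have := tendsto_nhdsGT_of_continuousOn h.pos h.continuousOn_disp
  rwa [disp, h.map_zero, sub_zero] at this

theorem tendsto_deriv (h : ParabolicContraction C L g g₁ g₂) :
    Tendsto g₁ (𝓝[>] 0) (𝓝 1) := by
  have := tendsto_nhdsGT_of_continuousOn h.pos h.continuousOn₁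
  rwa [h.deriv_zero] at this

theorem tendsto_one_sub_deriv_div (h : ParabolicContraction C L g g₁ g₂) :
    Tendsto (fun x => (1 - g₁ x) / x) (𝓝[>] 0) (𝓝 (-g₂ 0)) := by
  refine HasDerivAt.lhopital_zero_nhdsGT (f' := fun x => -g₂ x) (g' := fun _ => 1) ?_ ?_ ?_ ?_ ?_ ?_
  · filter_upwards [h.Ioo_mem_nhdsGT_zero] with x hx using (h.hasDerivAt₁ x hx).const_sub 1
  · exact Eventually.of_forall fun x => hasDerivAt_id x
  · exact Eventually.of_forall fun x => one_ne_zero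
  · simpa using h.tendsto_deriv.const_sub 1
  · exact tendsto_id.mono_left nhdsWithin_le_nhds
  · simpa using (tendsto_nhdsGT_of_continuousOn h.pos h.continuousOn₂).neg

theorem tendsto_disp_div_sq (h : ParabolicContraction C L g g₁ g₂) :
    Tendsto (fun x => disp g x / x ^ 2) (𝓝[>] 0) (𝓝 (-g₂ 0 / 2)) := by
  refine HasDerivAt.lhopital_zero_nhdsGT (f' := fun x => 1 - g₁ x) (g' := fun x => 2 * x)
    ?_ ?_ ?_ ?_ ?_ ?_
  · filter_upwards [h.Ioo_mem_nhdsGT_zero] with x hx using h.hasDerivAt_disp hx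
  · exact Eventually.of_forall fun x => by simpa using hasDerivAt_pow 2 x
  · filter_upwards [self_mem_nhdsWithin] with x hx
    exact mul_ne_zero two_ne_zero (ne_of_gt hx)
  · exact h.tendsto_disp
  · have : Continuous fun x : ℝ => x ^ 2 := by fun_prop
    simpa using (this.tendsto 0).mono_left nhdsWithin_le_nhds
  · refine (h.tendsto_one_sub_deriv_div.div_const 2).congr fun x => ?_
    rw [div_div, mul_comm x]

theorem deriv₂_zero_nonpos (h : ParabolicContraction C L g g₁ g₂) : g₂ 0 ≤ 0 := by
  have : 0 ≤ -g₂ 0 / 2 := by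
    refine ge_of_tendsto h.tendsto_disp_div_sq ?_
    filter_upwards [h.Ioo_mem_nhdsGT_zero] with x hx
    exact div_nonneg (h.disp_pos hx).le (sq_nonneg x)
  linarith

/-- In the degenerate case the quotient `disp g x / x ^ 2` tends to `0`, so comparison with powers
of `x` is useless. Instead `sq_deriv_le` is applied near `0`, where the Lipschitz constant of `g₁`
is arbitrarily small. -/
theorem tendsto_one_sub_deriv_div_sqrt_of_eq_zero (h : ParabolicContraction C L g g₁ g₂)
    (h0 : g₂ 0 = 0) :
    Tendsto (fun x => (1 - g₁ x) / √(disp g x)) (𝓝[>] 0) (𝓝 0) := by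
  rw [Metric.tendsto_nhds]
  intro ε hε
  have hlim := tendsto_nhdsGT_of_continuousOn h.pos h.continuousOn₂
  rw [h0] at hlim
  have hε' : 0 < ε ^ 2 / 8 := by positivity
  have hev : ∀ᶠ x in 𝓝[>] (0 : ℝ), |g₂ x| < ε ^ 2 / 8 := by
    have := hlim.abs
    rw [abs_zero] at this
    exact this.eventually (gt_mem_nhds hε')
  obtain ⟨δ', hδ', hδs'⟩ := (mem_nhdsGT_iff_exists_Ioo_subset).1 (hev.and h.Ioo_mem_nhdsGT_zero)
  rw [mem_Ioi] at hδ'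
  obtain ⟨δ, hδ, hδδ'⟩ := exists_between hδ'
  have hδL : δ ∈ Ioo 0 L := (hδs' ⟨hδ, hδδ'⟩).2
  have hLip : ∀ s ∈ Icc 0 δ, ∀ t ∈ Icc 0 δ, |g₁ t - g₁ s| ≤ ε ^ 2 / 8 * |t - s| :=
    fun s hs t ht => abs_sub_le_of_abs_deriv_le
      (h.continuousOn₁.mono (Icc_subset_Icc le_rfl hδL.2.le))
      (fun y hy => h.hasDerivAt₁ y (Ioo_subset_Ioo le_rfl hδL.2.le hy))
      (fun y hy => (hδs' ⟨hy.1, hy.2.trans hδδ'⟩).1.le) hs ht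
  -- For `x` below `δ / 2` the distance to `δ` exceeds `x`, which supplies the room on the right.
  filter_upwards [Ioo_mem_nhdsGT (half_pos hδ)] with x hx
  have hxδ : x ∈ Icc 0 δ := ⟨hx.1.le, by linarith [hx.2]⟩
  have hxL : x ∈ Ioo 0 L := ⟨hx.1, by linarith [hx.2, hδL.2]⟩
  have h1 : |1 - g₁ x| ≤ ε ^ 2 / 8 * x := by
    have := hLip x hxδ 0 (left_mem_Icc.2 hδ.le)
    rwa [h.deriv_zero, zero_sub, abs_neg, abs_of_pos hx.1] at this
  have h2 : (1 - g₁ x) ^ 2 ≤ 4 * (ε ^ 2 / 8) * disp g x := by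
    refine sq_deriv_le (h₁ := fun x => 1 - g₁ x) (u := 0) (v := δ) hε'
      (h.continuousOn_disp.mono (Icc_subset_Icc le_rfl hδL.2.le))
      (fun y hy => h.hasDerivAt_disp (Ioo_subset_Ioo le_rfl hδL.2.le hy)) ?_
      (fun y hy => h.disp_nonneg (Icc_subset_Icc le_rfl hδL.2.le hy)) hxδ ?_ ?_
    · intro s hs t ht
      have := hLip t ht s hs
      rwa [abs_sub_comm s, ← sub_sub_sub_cancel_left _ _ (1 : ℝ)] at this
    · rw [sub_zero]
      exact (le_abs_self _).trans h1
    · refine (neg_le_abs _).trans (h1.trans ?_)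
      gcongr
      linarith [hx.2]
  have hd := h.disp_pos hxL
  rw [dist_zero_right, norm_div, Real.norm_eq_abs, Real.norm_of_nonneg (Real.sqrt_nonneg _),
    div_lt_iff₀ (Real.sqrt_pos.2 hd)]
  apply lt_of_pow_lt_pow_left₀ 2 (by positivity)
  rw [sq_abs, mul_pow, Real.sq_sqrt hd.le]
  nlinarith [mul_pos (pow_pos hε 2) hd]

theorem tendsto_one_sub_deriv_div_sqrt (h : ParabolicContraction C L g g₁ g₂) :
    Tendsto (fun x => (1 - g₁ x) / √(disp g x)) (𝓝[>] 0) (𝓝 (2 * √(-g₂ 0 / 2))) := by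
  rcases h.deriv₂_zero_nonpos.eq_or_lt with h0 | h0
  · simpa [h0] using h.tendsto_one_sub_deriv_div_sqrt_of_eq_zero h0
  have hpos : 0 < -g₂ 0 / 2 := by linarith
  have h1 := h.tendsto_one_sub_deriv_div.div h.tendsto_disp_div_sq.sqrt (Real.sqrt_pos.2 hpos).ne'
  have e : -g₂ 0 / √(-g₂ 0 / 2) = 2 * √(-g₂ 0 / 2) := by
    rw [div_eq_iff (Real.sqrt_pos.2 hpos).ne', mul_assoc, Real.mul_self_sqrt hpos.le]
    ring
  rw [e] at h1
  refine h1.congr' ?_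
  filter_upwards [h.Ioo_mem_nhdsGT_zero] with x hx
  have hx0 := hx.1
  rw [Pi.div_apply, Real.sqrt_div (h.disp_pos hx).le, Real.sqrt_sq hx0.le,
    div_div_div_cancel_right₀ hx0.ne']

theorem disp_apply_div_bounds (h : ParabolicContraction C L g g₁ g₂) {x : ℝ} (hx : x ∈ Ioo 0 L) :
    |disp g (g x) / disp g x - g₁ x| ≤ C * disp g x ∧ 1 ≤ C * (disp g (g x) / disp g x) := by
  obtain ⟨ξ, hξ, he⟩ := h.exists_disp_apply_eq hx
  have hξ' : ξ ∈ Icc 0 L := ⟨((h.mapsTo hx).1.trans hξ.1).le, (hξ.2.trans hx.2).le⟩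
  rw [he, mul_div_cancel_right₀ _ (h.disp_pos hx).ne']
  refine ⟨(h.abs_deriv_sub_le (Ioo_subset_Icc_self hx) hξ').trans ?_, h.one_le ξ hξ'⟩
  have := h.C_pos
  gcongr
  rw [abs_sub_comm, abs_of_pos (sub_pos.2 hξ.2)]
  exact sub_le_sub_left hξ.1.le _

theorem inv_sqrt_disp_sub (h : ParabolicContraction C L g g₁ g₂) {x : ℝ} (hx : x ∈ Ioo 0 L) :
    (√(disp g (g x)))⁻¹ - (√(disp g x))⁻¹ =
      (1 - disp g (g x) / disp g x) / √(disp g x) /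
        (√(disp g (g x) / disp g x) * (1 + √(disp g (g x) / disp g x))) := by
  have h1 := h.disp_pos hx
  have h2 := h.disp_pos (h.mapsTo hx)
  set q := disp g (g x) / disp g x with hq
  have hqp : 0 < q := div_pos h2 h1
  have e : disp g (g x) = q * disp g x := by rw [hq, div_mul_cancel₀ _ h1.ne']
  have hsq : 0 < √q := Real.sqrt_pos.2 hqp
  have hsd : 0 < √(disp g x) := Real.sqrt_pos.2 h1
  have e2 : 1 - q = (1 - √q) * (1 + √q) := by
    have := Real.sq_sqrt hqp.le
    linear_combination this
  rw [e, Real.sqrt_mul hqp.le, e2]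
  have : 1 + √q ≠ 0 := by positivity
  field_simp

/-- With `q` the ratio of consecutive displacements, the increment is `(1 - q) / √disp` divided by
`√q (1 + √q)`. Here `q` differs from `g₁ x` by at most `C * disp g x`, which is negligible against
the square root, and the denominator tends to `2`. -/
theorem tendsto_inv_sqrt_disp_sub (h : ParabolicContraction C L g g₁ g₂) :
    Tendsto (fun x => (√(disp g (g x)))⁻¹ - (√(disp g x))⁻¹) (𝓝[>] 0)
      (𝓝 (√(-g₂ 0 / 2))) := by
  have hq0 : Tendsto (fun x => disp g (g x) / disp g x - g₁ x) (𝓝[>] 0) (𝓝 0) := by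
    refine squeeze_zero_norm' ?_ (by simpa using h.tendsto_disp.const_mul C)
    filter_upwards [h.Ioo_mem_nhdsGT_zero] with x hx using (h.disp_apply_div_bounds hx).1
  have hq : Tendsto (fun x => disp g (g x) / disp g x) (𝓝[>] 0) (𝓝 1) := by
    simpa using hq0.add h.tendsto_deriv
  have hr0 : Tendsto (fun x => (disp g (g x) / disp g x - g₁ x) / √(disp g x)) (𝓝[>] 0)
      (𝓝 0) := by
    refine squeeze_zero_norm' (a := fun x => C * √(disp g x)) ?_
      (by simpa using h.tendsto_disp.sqrt.const_mul C)
    filter_upwards [h.Ioo_mem_nhdsGT_zero] with x hx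
    have hd := h.disp_pos hx
    rw [norm_div, Real.norm_eq_abs, Real.norm_of_nonneg (Real.sqrt_nonneg _),
      div_le_iff₀ (Real.sqrt_pos.2 hd), mul_assoc, Real.mul_self_sqrt hd.le]
    exact (h.disp_apply_div_bounds hx).1
  have hr : Tendsto (fun x => (1 - disp g (g x) / disp g x) / √(disp g x)) (𝓝[>] 0)
      (𝓝 (2 * √(-g₂ 0 / 2))) := by
    have := h.tendsto_one_sub_deriv_div_sqrt.sub hr0
    rw [sub_zero] at this
    refine this.congr fun x => ?_
    rw [← sub_div, sub_sub_sub_cancel_right]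
  have hden : Tendsto (fun x => √(disp g (g x) / disp g x) * (1 + √(disp g (g x) / disp g x)))
      (𝓝[>] 0) (𝓝 2) := by
    have := hq.sqrt.mul (hq.sqrt.const_add 1)
    norm_num at this
    exact this
  have := hr.div hden two_ne_zero
  rw [mul_div_cancel_left₀ _ two_ne_zero] at this
  refine this.congr' ?_
  filter_upwards [h.Ioo_mem_nhdsGT_zero] with x hx using (h.inv_sqrt_disp_sub hx).symm

/-- A bound valid at every point and depending on `C` alone; this is what makes the growth estimate
uniform over all components. -/
theorem inv_sqrt_disp_sub_le (h : ParabolicContraction C L g g₁ g₂) {x : ℝ} (hx : x ∈ Ioo 0 L) :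
    (√(disp g (g x)))⁻¹ - (√(disp g x))⁻¹ ≤ 2 * C + C ^ 2 := by
  have hC := h.C_pos
  have h1 := h.disp_pos hx
  have hsd : 0 < √(disp g x) := Real.sqrt_pos.2 h1
  obtain ⟨hq1, hq2⟩ := h.disp_apply_div_bounds hx
  have hl := h.sq_one_sub_deriv_le (Ioo_subset_Icc_self hx)
  rw [h.inv_sqrt_disp_sub hx]
  set q := disp g (g x) / disp g x
  have hqp : 0 < q := pos_of_mul_pos_right (by linarith) hC.le
  have hsq : 0 < √q := Real.sqrt_pos.2 hqp
  have hsC : 0 < √C := Real.sqrt_pos.2 hC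
  have hCq : 1 ≤ √C * √q := by
    rw [← Real.sqrt_mul hC.le, Real.one_le_sqrt]
    exact hq2
  have hdC : √(disp g x) ≤ √C :=
    Real.sqrt_le_sqrt ((h.disp_le_self hx).trans (hx.2.le.trans h.le))
  have h3 : 1 - g₁ x ≤ 2 * √C * √(disp g x) := by
    apply le_of_sq_le_sq _ (by positivity)
    rw [mul_pow, mul_pow, Real.sq_sqrt hC.le, Real.sq_sqrt h1.le]
    linarith
  have h4 : 1 - q ≤ (2 * √C + C * √C) * √(disp g x) := by
    have h5 : C * disp g x ≤ C * √C * √(disp g x) := by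
      rw [mul_assoc]
      gcongr
      nth_rewrite 1 [← Real.mul_self_sqrt h1.le]
      gcongr
    have := (abs_le.1 hq1).1
    linarith
  rw [div_div, div_le_iff₀ (by positivity)]
  have hCC := Real.mul_self_sqrt hC.le
  calc 1 - q ≤ (2 * √C + C * √C) * √(disp g x) * 1 := by linarith
    _ ≤ (2 * √C + C * √C) * √(disp g x) * (√C * √q * (1 + √q)) := by
        gcongr
        nlinarith
    _ = (2 + C) * (√C * √C) * (√(disp g x) * (√q * (1 + √q))) := by ring
    _ = _ := by rw [hCC]; ring

theorem inv_sqrt_disp_iterate_le (h : ParabolicContraction C L g g₁ g₂) {x : ℝ} (hx : x ∈ Ioo 0 L)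
    (n : ℕ) :
    (√(disp g (g^[n] x)))⁻¹ ≤ (√(disp g x))⁻¹ + n * (2 * C + C ^ 2) := by
  induction n with
  | zero => simp
  | succ n ih =>
    have := h.inv_sqrt_disp_sub_le (h.iterate_mem hx n)
    rw [Function.iterate_succ_apply']
    push_cast
    linarith

/-- The derivatives of the iterates of the inverse of `g` grow at most quadratically, and the
growth is controlled by the displacement. -/
theorem inv_iterDeriv_le (h : ParabolicContraction C L g g₁ g₂) {x : ℝ} (hx : x ∈ Ioo 0 L)
    (n : ℕ) :
    (iterDeriv g g₁ n x)⁻¹ ≤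
      2 * Real.exp (C * C) ^ 2 * (1 + (2 * C + C ^ 2) ^ 2 * (n ^ 2 * disp g x)) := by
  have hC := h.C_pos
  have hp := h.iterate_mem hx n
  have hd := h.disp_pos hx
  have hdp := h.disp_pos hp
  set s := √(disp g x) with hs
  have hs0 : 0 < s := Real.sqrt_pos.2 hd
  have hss : disp g x = s ^ 2 := (Real.sq_sqrt hd.le).symm
  have h1 : (iterDeriv g g₁ n x)⁻¹ = szekeres L g g₁ x / szekeres L g g₁ (g^[n] x) := by
    have := (szekeres_pos (g := g) (g₁ := g₁) hx).ne'
    have := (h.iterDeriv_pos hx n).ne'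
    rw [h.szekeres_iterate hx]
    field_simp
  have h2 : szekeres L g g₁ x / szekeres L g g₁ (g^[n] x) ≤
      Real.exp (C * C) ^ 2 * (s ^ 2 * ((√(disp g (g^[n] x)))⁻¹) ^ 2) := by
    rw [div_le_iff₀ (szekeres_pos hp), inv_pow, Real.sq_sqrt hdp.le, ← hss]
    have h3 := h.szekeres_le' hx
    have h4 := h.disp_le_szekeres hp
    calc _ ≤ Real.exp (C * C) * disp g x * 1 := by linarith
      _ ≤ Real.exp (C * C) * disp g x *
          ((disp g (g^[n] x))⁻¹ * (Real.exp (C * C) * szekeres L g g₁ (g^[n] x))) := by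
          gcongr
          rw [← div_eq_inv_mul, one_le_div hdp]
          exact h4
      _ = _ := by ring
  have h5 : s ^ 2 * ((√(disp g (g^[n] x)))⁻¹) ^ 2 ≤ (1 + (2 * C + C ^ 2) * (n * s)) ^ 2 := by
    rw [← mul_pow]
    gcongr
    have := h.inv_sqrt_disp_iterate_le hx n
    calc _ ≤ s * (s⁻¹ + n * (2 * C + C ^ 2)) := by gcongr
      _ = _ := by field_simp
  rw [h1]
  refine h2.trans ?_
  -- The factor `2` comes from `(1 + t) ^ 2 ≤ 2 * (1 + t ^ 2)`.
  rw [mul_comm 2 (Real.exp (C * C) ^ 2), mul_assoc]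
  refine mul_le_mul_of_nonneg_left (h5.trans ?_) (by positivity)
  rw [hss]
  nlinarith [sq_nonneg (1 - (2 * C + C ^ 2) * (n * s))]

/-- The product filter expresses convergence uniform in a neighbourhood of `y₀`, in a form that
composes with limits at `0`. -/
theorem tendsto_iterate_prod (h : ParabolicContraction C L g g₁ g₂) {y₀ : ℝ} (hy : y₀ ∈ Ioo 0 L) :
    Tendsto (fun p : ℕ × ℝ => g^[p.1] p.2) (atTop ×ˢ 𝓝 y₀) (𝓝[>] 0) := by
  have hy2 : (y₀ + L) / 2 ∈ Ioo 0 L := ⟨by linarith [hy.1, h.pos], by linarith [hy.2]⟩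
  have hev : ∀ᶠ p : ℕ × ℝ in atTop ×ˢ 𝓝 y₀, p.2 ∈ Ioo 0 ((y₀ + L) / 2) :=
    tendsto_snd.eventually (isOpen_Ioo.mem_nhds ⟨hy.1, by linarith [hy.2]⟩)
  refine tendsto_nhdsWithin_iff.2 ⟨?_, ?_⟩
  · refine squeeze_zero' ?_ ?_ ((h.tendsto_iterate hy2).comp tendsto_fst)
    · filter_upwards [hev] with p hp
      exact (h.iterate_mem ⟨hp.1, hp.2.trans hy2.2⟩ p.1).1.le
    · filter_upwards [hev] with p hp
      exact h.iterate_mono ⟨hp.1, hp.2.trans hy2.2⟩ hy2 hp.2.le p.1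
  · filter_upwards [hev] with p hp
    exact (h.iterate_mem ⟨hp.1, hp.2.trans hy2.2⟩ p.1).1

/-- A Stolz–Cesàro argument: the increments converge, so the averages have the same limit.
Uniformity near `y₀` needs a common starting index `N` and a common bound on the value at that
index. -/
theorem tendsto_inv_sqrt_disp_iterate_div (h : ParabolicContraction C L g g₁ g₂) {y₀ : ℝ}
    (hy : y₀ ∈ Ioo 0 L) :
    Tendsto (fun p : ℕ × ℝ => (√(disp g (g^[p.1] p.2)))⁻¹ / p.1) (atTop ×ˢ 𝓝 y₀)
      (𝓝 (√(-g₂ 0 / 2))) := by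
  set β := √(-g₂ 0 / 2) with hβ
  have hβ0 : 0 ≤ β := Real.sqrt_nonneg _
  rw [Metric.tendsto_nhds]
  intro ε hε
  have h1 := (Metric.tendsto_nhds.1 (h.tendsto_inv_sqrt_disp_sub.comp (h.tendsto_iterate_prod hy)))
    (ε / 2) (half_pos hε)
  obtain ⟨pa, ha, pb, hb, hab⟩ := eventually_prod_iff.1 h1
  obtain ⟨N, hN⟩ := eventually_atTop.1 ha
  have hbd : ∀ᶠ y in 𝓝 y₀, (√(disp g (g^[N] y)))⁻¹ < (√(disp g (g^[N] y₀)))⁻¹ + 1 := by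
    have hp := h.iterate_mem hy N
    have h2 : ContinuousAt (fun y => (√(disp g (g^[N] y)))⁻¹) y₀ :=
      (((h.hasDerivAt_disp hp).continuousAt.comp
        (h.hasDerivAt_iterate hy N).continuousAt).sqrt).inv₀ (Real.sqrt_pos.2 (h.disp_pos hp)).ne'
    exact h2.eventually (gt_mem_nhds (by linarith))
  set B := (√(disp g (g^[N] y₀)))⁻¹ + 1
  have hBn : ∀ᶠ n : ℕ in atTop, (B + N * β) / (ε / 2) < n :=
    (tendsto_natCast_atTop_atTop (R := ℝ)).eventually_gt_atTop _
  have hfst : ∀ᶠ n : ℕ in atTop, N ≤ n ∧ 0 < n ∧ (B + N * β) / (ε / 2) < n :=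
    (eventually_ge_atTop N).and ((eventually_gt_atTop 0).and hBn)
  filter_upwards [tendsto_fst.eventually hfst, tendsto_snd.eventually (hb.and hbd)]
    with ⟨n, y⟩ hn hyy
  obtain ⟨hNn, hn0, hnB⟩ := hn
  obtain ⟨hpb, hyB⟩ := hyy
  simp only at hNn hn0 hnB hpb hyB ⊢
  have hsum : ∀ m ≥ N, |(√(disp g (g^[m] y)))⁻¹ - (√(disp g (g^[N] y)))⁻¹ - (m - N) * β| ≤
      ε / 2 * (m - N) := by
    intro m hm
    induction m, hm using Nat.le_induction with
    | base => simp
    | succ m hm ih =>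
      have h3 := hab (hN m hm) hpb
      simp only [Function.comp, Real.dist_eq, ← hβ] at h3
      rw [Function.iterate_succ_apply']
      push_cast
      rw [_root_.abs_le] at ih ⊢
      rw [abs_lt] at h3
      constructor <;> nlinarith
  have h4 := hsum n hNn
  have hn0' : (0 : ℝ) < n := by exact_mod_cast hn0
  have hu : 0 ≤ (√(disp g (g^[N] y)))⁻¹ := inv_nonneg.2 (Real.sqrt_nonneg _)
  rw [div_lt_iff₀ (half_pos hε)] at hnB
  rw [Real.dist_eq, div_sub' hn0'.ne', abs_div, abs_of_pos hn0', div_lt_iff₀ hn0', abs_lt]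
  rw [_root_.abs_le] at h4
  have hNβ : 0 ≤ N * β := by positivity
  have hNε : 0 ≤ ε / 2 * N := by positivity
  constructor <;> nlinarith

/-- The growth of the derivatives of the iterates of the inverse of `g`, locally uniformly. -/
theorem tendsto_inv_iterDeriv_div_sq (h : ParabolicContraction C L g g₁ g₂) {y₀ : ℝ}
    (hy : y₀ ∈ Ioo 0 L) :
    Tendsto (fun p : ℕ × ℝ => (iterDeriv g g₁ p.1 p.2)⁻¹ / (p.1 : ℝ) ^ 2) (atTop ×ˢ 𝓝 y₀)
      (𝓝 (-g₂ 0 / 2 * szekeres L g g₁ y₀)) := by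
  have h1 := (h.tendsto_inv_sqrt_disp_iterate_div hy).pow 2
  rw [Real.sq_sqrt (by linarith [h.deriv₂_zero_nonpos])] at h1
  -- The inverse derivative is `X y / X (g^n y)`, the product of `1 / disp (g^n y)`, of `disp / X`
  -- at `g^n y`, and of `X y`.
  have h2 := (h.tendsto_szekeres_div_disp.inv₀ one_ne_zero).comp (h.tendsto_iterate_prod hy)
  have h3 : Tendsto (fun p : ℕ × ℝ => szekeres L g g₁ p.2) (atTop ×ˢ 𝓝 y₀)
      (𝓝 (szekeres L g g₁ y₀)) :=
    (h.hasDerivAt_szekeres hy).continuousAt.tendsto.comp tendsto_snd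
  have h4 := (h1.mul h2).mul h3
  rw [inv_one, mul_one] at h4
  refine h4.congr' ?_
  filter_upwards [tendsto_snd.eventually (isOpen_Ioo.mem_nhds hy)] with p hp
  have hq := h.iterate_mem hp p.1
  have hd := h.disp_pos hq
  have hs := szekeres_pos (g := g) (g₁ := g₁) hp
  have hi := h.iterDeriv_pos hp p.1
  simp only [Function.comp]
  rw [h.szekeres_iterate hp, div_pow, inv_pow, Real.sq_sqrt hd.le]
  field_simp

end ParabolicContraction

/-! ### Diffeomorphisms of `[a, b]`: inverses, iterates, fixed points and components. -/

namespace IsC2Diffeo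

variable {a b : ℝ} {f : ℝ → ℝ}

theorem invOn (hf : IsC2Diffeo a b f) : InvOn (inverse a b f) f (Icc a b) (Icc a b) :=
  hf.bijOn.invOn_invFunOn

theorem mapsTo (hf : IsC2Diffeo a b f) : MapsTo f (Icc a b) (Icc a b) := hf.bijOn.mapsTo

theorem bijOn_inverse (hf : IsC2Diffeo a b f) : BijOn (inverse a b f) (Icc a b) (Icc a b) :=
  (bijOn_comm hf.invOn).2 hf.bijOn

theorem apply_inverse (hf : IsC2Diffeo a b f) {x : ℝ} (hx : x ∈ Icc a b) :
    f (inverse a b f x) = x := hf.invOn.2 hx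

theorem inverse_apply (hf : IsC2Diffeo a b f) {x : ℝ} (hx : x ∈ Icc a b) :
    inverse a b f (f x) = x := hf.invOn.1 hx

theorem strictMonoOn (hf : IsC2Diffeo a b f) : StrictMonoOn f (Icc a b) :=
  hf.monotoneOn.strictMonoOn_of_injOn hf.bijOn.injOn

/-- Values off `[a, b]` are arbitrary, so the double inverse is compared with `f` only on the
interval. This suffices for the inverse to satisfy the same hypotheses as `f`. -/
theorem eqOn_inverse_inverse (hf : IsC2Diffeo a b f) :
    EqOn (inverse a b (inverse a b f)) f (Icc a b) := by
  intro x hx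
  have h1 : inverse a b (inverse a b f) x ∈ Icc a b :=
    (hf.bijOn_inverse.invOn_invFunOn.symm.bijOn
      hf.bijOn_inverse.surjOn.mapsTo_invFunOn hf.bijOn_inverse.mapsTo).mapsTo hx
  have h2 : inverse a b f (inverse a b (inverse a b f) x) = x :=
    hf.bijOn_inverse.invOn_invFunOn.2 hx
  rw [← hf.apply_inverse h1, h2]

theorem inverse (hf : IsC2Diffeo a b f) : IsC2Diffeo a b (inverse a b f) where
  bijOn := hf.bijOn_inverse
  monotoneOn := by
    intro x hx y hy hxy
    by_contra hlt
    rw [not_le] at hlt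
    have := hf.strictMonoOn (hf.bijOn_inverse.mapsTo hy) (hf.bijOn_inverse.mapsTo hx) hlt
    rw [hf.apply_inverse hx, hf.apply_inverse hy] at this
    exact hxy.not_gt this
  contDiffOn := hf.contDiffOn_inverse
  contDiffOn_inverse := hf.contDiffOn.congr hf.eqOn_inverse_inverse

theorem inverse_eq_self_iff (hf : IsC2Diffeo a b f) {x : ℝ} (hx : x ∈ Icc a b) :
    IntervalDiffeo.inverse a b f x = x ↔ f x = x := by
  constructor
  · intro h
    have := hf.apply_inverse hx
    rwa [h] at this
  · intro h
    have := hf.inverse_apply hx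
    rwa [h] at this

theorem left_fixed (hf : IsC2Diffeo a b f) (hab : a ≤ b) : f a = a := by
  have ha : a ∈ Icc a b := left_mem_Icc.2 hab
  obtain ⟨x, hx, hxa⟩ := hf.bijOn.surjOn ha
  exact le_antisymm ((hf.monotoneOn ha hx hx.1).trans hxa.le) (hf.mapsTo ha).1

theorem right_fixed (hf : IsC2Diffeo a b f) (hab : a ≤ b) : f b = b := by
  have hb : b ∈ Icc a b := right_mem_Icc.2 hab
  obtain ⟨x, hx, hxb⟩ := hf.bijOn.surjOn hb
  exact le_antisymm (hf.mapsTo hb).2 (hxb.ge.trans (hf.monotoneOn hx hb hx.2))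

theorem hasDerivWithinAt (hf : IsC2Diffeo a b f) {x : ℝ} (hx : x ∈ Icc a b) :
    HasDerivWithinAt f (derivWithin f (Icc a b) x) (Icc a b) x :=
  (hf.contDiffOn.differentiableOn two_ne_zero x hx).hasDerivWithinAt

theorem contDiffOn_derivWithin (hf : IsC2Diffeo a b f) (hab : a < b) :
    ContDiffOn ℝ 1 (derivWithin f (Icc a b)) (Icc a b) :=
  hf.contDiffOn.derivWithin (uniqueDiffOn_Icc hab) (by norm_num)

theorem secondDeriv_eq (a b : ℝ) (f : ℝ → ℝ) (x : ℝ) :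
    secondDeriv a b f x = derivWithin (derivWithin f (Icc a b)) (Icc a b) x := by
  rw [secondDeriv, iteratedDerivWithin_succ, iteratedDerivWithin_one]

theorem hasDerivWithinAt₂ (hf : IsC2Diffeo a b f) (hab : a < b) {x : ℝ} (hx : x ∈ Icc a b) :
    HasDerivWithinAt (derivWithin f (Icc a b)) (secondDeriv a b f x) (Icc a b) x := by
  rw [secondDeriv_eq]
  exact ((hf.contDiffOn_derivWithin hab).differentiableOn one_ne_zero x hx).hasDerivWithinAt

theorem continuousOn_secondDeriv (hf : IsC2Diffeo a b f) (hab : a < b) :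
    ContinuousOn (secondDeriv a b f) (Icc a b) :=
  hf.contDiffOn.continuousOn_iteratedDerivWithin le_rfl (uniqueDiffOn_Icc hab)

theorem derivWithin_inverse_mul (hf : IsC2Diffeo a b f) (hab : a < b) {x : ℝ}
    (hx : x ∈ Icc a b) :
    derivWithin (IntervalDiffeo.inverse a b f) (Icc a b) (f x) * derivWithin f (Icc a b) x = 1 := by
  have h1 := (hf.inverse.hasDerivWithinAt (hf.mapsTo hx)).comp x (hf.hasDerivWithinAt hx) hf.mapsTo
  have h2 : HasDerivWithinAt (IntervalDiffeo.inverse a b f ∘ f) 1 (Icc a b) x :=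
    (hasDerivWithinAt_id x _).congr (fun y hy => hf.inverse_apply hy) (hf.inverse_apply hx)
  exact (uniqueDiffOn_Icc hab x hx).eq_deriv _ h1 h2

theorem derivWithin_pos (hf : IsC2Diffeo a b f) (hab : a < b) {x : ℝ} (hx : x ∈ Icc a b) :
    0 < derivWithin f (Icc a b) x := by
  refine lt_of_le_of_ne hf.monotoneOn.derivWithin_nonneg fun h => ?_
  have := hf.derivWithin_inverse_mul hab hx
  rw [← h, mul_zero] at this
  exact zero_ne_one this

theorem iterate_mem (hf : IsC2Diffeo a b f) {x : ℝ} (hx : x ∈ Icc a b) (n : ℕ) :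
    f^[n] x ∈ Icc a b :=
  hf.mapsTo.iterate n hx

theorem hasDerivWithinAt_iterate (hf : IsC2Diffeo a b f) {x : ℝ} (hx : x ∈ Icc a b) (n : ℕ) :
    HasDerivWithinAt (f^[n]) (iterDeriv f (derivWithin f (Icc a b)) n x) (Icc a b) x := by
  induction n with
  | zero => simpa [iterDeriv] using hasDerivWithinAt_id x (Icc a b)
  | succ n ih =>
    rw [Function.iterate_succ', iterDeriv_succ, mul_comm]
    exact (hf.hasDerivWithinAt (hf.iterate_mem hx n)).comp x ih (hf.mapsTo.iterate n)

theorem derivWithin_iterate (hf : IsC2Diffeo a b f) (hab : a < b) {x : ℝ} (hx : x ∈ Icc a b)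
    (n : ℕ) :
    derivWithin (f^[n]) (Icc a b) x = iterDeriv f (derivWithin f (Icc a b)) n x :=
  (hf.hasDerivWithinAt_iterate hx n).derivWithin (uniqueDiffOn_Icc hab x hx)

theorem inverse_iterate_iterate (hf : IsC2Diffeo a b f) {x : ℝ} (hx : x ∈ Icc a b) (n : ℕ) :
    (IntervalDiffeo.inverse a b f)^[n] (f^[n] x) = x := by
  induction n with
  | zero => rfl
  | succ n ih =>
    rw [Function.iterate_succ_apply, Function.iterate_succ_apply',
      hf.inverse_apply (hf.iterate_mem hx n), ih]

theorem iterate_inverse_iterate (hf : IsC2Diffeo a b f) {x : ℝ} (hx : x ∈ Icc a b) (n : ℕ) :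
    f^[n] ((IntervalDiffeo.inverse a b f)^[n] x) = x := by
  induction n with
  | zero => rfl
  | succ n ih =>
    rw [Function.iterate_succ_apply, Function.iterate_succ_apply',
      hf.apply_inverse (hf.inverse.iterate_mem hx n), ih]

/-- The derivative of `f^[n]` at `x` in terms of the inverse of `f`. -/
theorem derivWithin_iterate_eq_inv (hf : IsC2Diffeo a b f) (hab : a < b) {x : ℝ}
    (hx : x ∈ Icc a b) (n : ℕ) :
    derivWithin (f^[n]) (Icc a b) x =
      (iterDeriv (IntervalDiffeo.inverse a b f)
        (derivWithin (IntervalDiffeo.inverse a b f) (Icc a b)) n (f^[n] x))⁻¹ := by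
  have hx' := hf.iterate_mem hx n
  have h1 := (hf.inverse.hasDerivWithinAt_iterate hx' n).comp x
    (hf.hasDerivWithinAt_iterate hx n) (hf.mapsTo.iterate n)
  have h2 : HasDerivWithinAt ((IntervalDiffeo.inverse a b f)^[n] ∘ f^[n]) 1 (Icc a b) x :=
    (hasDerivWithinAt_id x _).congr (fun y hy => hf.inverse_iterate_iterate hy n)
      (hf.inverse_iterate_iterate hx n)
  rw [hf.derivWithin_iterate hab hx]
  exact eq_inv_of_mul_eq_one_right ((uniqueDiffOn_Icc hab x hx).eq_deriv _ h1 h2)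

theorem continuousOn_derivWithin_iterate (hf : IsC2Diffeo a b f) (hab : a < b) (n : ℕ) :
    ContinuousOn (fun x => derivWithin (f^[n]) (Icc a b) x) (Icc a b) := by
  have : ContinuousOn (iterDeriv f (derivWithin f (Icc a b)) n) (Icc a b) :=
    continuousOn_finsetProd _ fun i _ =>
      (hf.contDiffOn_derivWithin hab).continuousOn.comp
        (fun x hx => (hf.hasDerivWithinAt_iterate hx i).continuousWithinAt)
        fun x hx => hf.iterate_mem hx i
  exact this.congr fun x hx => hf.derivWithin_iterate hab hx n

theorem derivWithin_inverse_of_fixed (hf : IsC2Diffeo a b f) (hab : a < b)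
    (hpar : OnlyParabolicFixedPoints a b f) :
    OnlyParabolicFixedPoints a b (IntervalDiffeo.inverse a b f) := by
  intro x hx hfx
  have hfx' := (hf.inverse_eq_self_iff hx).1 hfx
  have := hf.derivWithin_inverse_mul hab hx
  rwa [hfx', hpar x hx hfx', mul_one] at this

/-- Differentiate `(Dg ∘ f) * Df = 1` at the fixed point, where both first derivatives are `1`. -/
theorem secondDeriv_inverse_of_fixed (hf : IsC2Diffeo a b f) (hab : a < b)
    (hpar : OnlyParabolicFixedPoints a b f) {x : ℝ} (hx : x ∈ Icc a b) (hfx : f x = x) :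
    secondDeriv a b (IntervalDiffeo.inverse a b f) x = -secondDeriv a b f x := by
  have hgx := (hf.inverse_eq_self_iff hx).2 hfx
  have h0 : HasDerivWithinAt (derivWithin (IntervalDiffeo.inverse a b f) (Icc a b))
      (secondDeriv a b (IntervalDiffeo.inverse a b f) x) (Icc a b) (f x) := by
    rw [hfx]; exact hf.inverse.hasDerivWithinAt₂ hab hx
  have h1 := (h0.comp x (hf.hasDerivWithinAt hx) hf.mapsTo).mul (hf.hasDerivWithinAt₂ hab hx)
  have h2 : HasDerivWithinAt ((derivWithin (IntervalDiffeo.inverse a b f) (Icc a b) ∘ f) *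
      derivWithin f (Icc a b)) 0 (Icc a b) x :=
    (hasDerivWithinAt_const x _ (1 : ℝ)).congr
      (fun y hy => hf.derivWithin_inverse_mul hab hy) (hf.derivWithin_inverse_mul hab hx)
  have h3 := (uniqueDiffOn_Icc hab x hx).eq_deriv _ h1 h2
  rw [Function.comp_apply, hfx, hpar x hx hfx,
    hf.derivWithin_inverse_of_fixed hab hpar x hx hgx] at h3
  linarith

/-- A constant that controls the derivatives of `f`. -/
theorem exists_bound (hf : IsC2Diffeo a b f) (hab : a < b) :
    ∃ C, b - a ≤ C ∧ ∀ x ∈ Icc a b, 1 ≤ C * derivWithin f (Icc a b) x ∧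
      |secondDeriv a b f x| ≤ C ∧ |secondDeriv a b f x| ≤ C * derivWithin f (Icc a b) x := by
  obtain ⟨B, hB⟩ := isCompact_Icc.exists_bound_of_continuousOn (hf.continuousOn_secondDeriv hab)
  obtain ⟨z, hz, hmin⟩ := isCompact_Icc.exists_isMinOn (nonempty_Icc.2 hab.le)
    (hf.contDiffOn_derivWithin hab).continuousOn
  have hm := hf.derivWithin_pos hab hz
  set m := derivWithin f (Icc a b) z
  have hB0 : 0 ≤ B := (norm_nonneg _).trans (hB z hz)
  have hba : 0 < b - a := sub_pos.2 hab
  -- Each summand serves one bound: the length, the second derivative, its ratio to the first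
  -- derivative, and the lower bound on the first derivative.
  refine ⟨(b - a) + B + B / m + 1 / m, ?_, fun x hx => ?_⟩
  · have : 0 ≤ B + B / m + 1 / m := by positivity
    linarith
  have hmx : m ≤ derivWithin f (Icc a b) x := hmin hx
  have hBx : |secondDeriv a b f x| ≤ B := hB x hx
  refine ⟨?_, ?_, ?_⟩
  · calc 1 = 1 / m * m := by field_simp
      _ ≤ ((b - a) + B + B / m + 1 / m) * derivWithin f (Icc a b) x := by
        gcongr
        have : 0 ≤ (b - a) + B + B / m := by positivity
        linarith
  · have : 0 ≤ (b - a) + B / m + 1 / m := by positivity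
    linarith
  · refine hBx.trans ?_
    calc B = B / m * m := by field_simp
      _ ≤ ((b - a) + B + B / m + 1 / m) * derivWithin f (Icc a b) x := by
        gcongr
        have : 0 ≤ (b - a) + B + 1 / m := by positivity
        linarith

/-- Every point that is not fixed lies in the interior of a component. -/
theorem exists_isComponent (hf : IsC2Diffeo a b f) {x : ℝ} (hx : x ∈ Icc a b) (hfx : f x ≠ x) :
    ∃ c d, IsComponent a b f c d ∧ x ∈ Ioo c d := by
  have hab : a ≤ b := hx.1.trans hx.2
  have key : ∀ u v, Icc u v ⊆ Icc a b → IsCompact {y ∈ Icc u v | f y = y} := by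
    intro u v huv
    refine isCompact_Icc.of_isClosed_subset ?_ (sep_subset _ _)
    have hc := (hf.contDiffOn.continuousOn.mono huv).sub continuousOn_id
    have := hc.preimage_isClosed_of_isClosed isClosed_Icc (isClosed_singleton (x := (0 : ℝ)))
    convert this using 1
    ext y
    simp [sub_eq_zero]
  -- The component is bounded by the fixed points nearest to `x` on either side.
  obtain ⟨c, hc, hcmax⟩ := (key a x (Icc_subset_Icc le_rfl hx.2)).exists_isGreatest
    ⟨a, left_mem_Icc.2 hx.1, hf.left_fixed hab⟩
  obtain ⟨d, hd, hdmin⟩ := (key x b (Icc_subset_Icc hx.1 le_rfl)).exists_isLeast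
    ⟨b, right_mem_Icc.2 hx.2, hf.right_fixed hab⟩
  have hcx : c < x := lt_of_le_of_ne hc.1.2 (by rintro rfl; exact hfx hc.2)
  have hxd : x < d := lt_of_le_of_ne hd.1.1 (by rintro rfl; exact hfx hd.2)
  refine ⟨c, d, ⟨hcx.trans hxd, Icc_subset_Icc hc.1.1 hd.1.2, hc.2, hd.2, fun y hy hfy => ?_⟩,
    hcx, hxd⟩
  rcases le_total y x with hyx | hxy
  · exact hy.1.not_ge (hcmax ⟨⟨hc.1.1.trans hy.1.le, hyx⟩, hfy⟩)
  · exact hy.2.not_ge (hdmin ⟨⟨hxy, hy.2.le.trans hd.1.2⟩, hfy⟩)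

end IsC2Diffeo

/-! ### Oriented charts, and transport of the model results to components. -/

/-- The map `f` in the coordinate `s = σ (x - p)`, for `σ = ±1`. -/
def chart (p σ : ℝ) (f : ℝ → ℝ) (s : ℝ) : ℝ := σ * (f (p + σ * s) - p)

/-- A component `[c, d]` with repelling endpoint `p`, where `σ` is the direction from `p` into the
component. -/
structure OrientedComponent (a b : ℝ) (f : ℝ → ℝ) (c d p σ : ℝ) : Prop where
  isComponent : IsComponent a b f c d
  endpoint : (σ = 1 ∧ p = c) ∨ (σ = -1 ∧ p = d)
  pos : ∀ x ∈ Ioo c d, 0 < σ * (f x - x)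

/-- Since `σ` is its own inverse, the inverse of the coordinate change has the same form with base
point `-(σ * p)`. One lemma thus transports fields into the chart and out of it. -/
theorem IsTimeOneMap.comp_affine {X f : ℝ → ℝ} {S S' : Set ℝ} {σ : ℝ} (hσ : σ * σ = 1) (p : ℝ)
    (hS : ∀ s, s ∈ S' ↔ p + σ * s ∈ S) (h : IsTimeOneMap X S f) :
    IsTimeOneMap (fun s => σ * X (p + σ * s)) S' (chart p σ f) := by
  have hinv : ∀ y, p + σ * (σ * (y - p)) = y := fun y => by
    rw [← mul_assoc, hσ]; ring
  intro s hs
  obtain ⟨φ, h0, h1, hm, hd⟩ := h _ ((hS s).1 hs)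
  refine ⟨fun t => σ * (φ t - p), ?_, ?_, fun t ht => ?_, fun t ht => ?_⟩
  · simp only [h0]
    rw [add_sub_cancel_left, ← mul_assoc, hσ, one_mul]
  · simp only [h1, chart]
  · rw [hS, hinv]
    exact hm t ht
  · simp only [hinv]
    exact ((hd t ht).sub_const p).const_mul σ

theorem contDiffOn_comp_affine {X : ℝ → ℝ} {S S' : Set ℝ} {n : WithTop ℕ∞} {σ : ℝ} (p : ℝ)
    (hS : ∀ s, s ∈ S' ↔ p + σ * s ∈ S) (h : ContDiffOn ℝ n X S) :
    ContDiffOn ℝ n (fun s => σ * X (p + σ * s)) S' :=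
  contDiffOn_const.mul (h.comp (by fun_prop) fun s hs => (hS s).1 hs)

namespace OrientedComponent

variable {a b c d p σ : ℝ} {f : ℝ → ℝ}

theorem sq (h : OrientedComponent a b f c d p σ) : σ * σ = 1 := by
  rcases h.endpoint with ⟨rfl, -⟩ | ⟨rfl, -⟩ <;> norm_num

theorem affine_mem_Icc_iff (h : OrientedComponent a b f c d p σ) (s : ℝ) :
    s ∈ Icc 0 (d - c) ↔ p + σ * s ∈ Icc c d := by
  rcases h.endpoint with ⟨rfl, rfl⟩ | ⟨rfl, rfl⟩ <;> constructor <;> rintro ⟨h1, h2⟩ <;>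
    constructor <;> linarith

theorem affine_mem_Ioo_iff (h : OrientedComponent a b f c d p σ) (s : ℝ) :
    s ∈ Ioo 0 (d - c) ↔ p + σ * s ∈ Ioo c d := by
  rcases h.endpoint with ⟨rfl, rfl⟩ | ⟨rfl, rfl⟩ <;> constructor <;> rintro ⟨h1, h2⟩ <;>
    constructor <;> linarith

theorem affine_mem_halfClosed_iff (h : OrientedComponent a b f c d p σ) (s : ℝ) :
    s ∈ Ico 0 (d - c) ↔ p + σ * s ∈ halfClosed c d p := by
  have hcd := h.isComponent.lt
  have hσ : σ ≠ 0 := by rintro rfl; simpa using h.sq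
  rw [halfClosed, mem_union, ← h.affine_mem_Ioo_iff, mem_singleton_iff, add_eq_left,
    mul_eq_zero, or_iff_right hσ]
  constructor
  · rintro ⟨h1, h2⟩
    rcases h1.eq_or_lt with h1 | h1
    · exact Or.inr h1.symm
    · exact Or.inl ⟨h1, h2⟩
  · rintro (⟨h1, h2⟩ | rfl)
    · exact ⟨h1.le, h2⟩
    · exact ⟨le_rfl, by linarith⟩

theorem affine_inv (h : OrientedComponent a b f c d p σ) (y : ℝ) :
    p + σ * (σ * (y - p)) = y := by
  rw [← mul_assoc, h.sq]; ring

theorem affine_inv' (h : OrientedComponent a b f c d p σ) (y : ℝ) :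
    p + σ * (-(σ * p) + σ * y) = y := by
  linear_combination (y - p) * h.sq

theorem mem_Icc (h : OrientedComponent a b f c d p σ) : p ∈ Icc a b := by
  have hcd := h.isComponent.lt.le
  rcases h.endpoint with ⟨-, rfl⟩ | ⟨-, rfl⟩
  · exact h.isComponent.subset (left_mem_Icc.2 hcd)
  · exact h.isComponent.subset (right_mem_Icc.2 hcd)

theorem fixed (h : OrientedComponent a b f c d p σ) : f p = p := by
  rcases h.endpoint with ⟨-, rfl⟩ | ⟨-, rfl⟩
  · exact h.isComponent.fixed_left
  · exact h.isComponent.fixed_right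

theorem chart_semiconj (h : OrientedComponent a b f c d p σ) (g : ℝ → ℝ) (s : ℝ) :
    p + σ * chart p σ g s = g (p + σ * s) :=
  h.affine_inv _

theorem iterate_chart (h : OrientedComponent a b f c d p σ) (g : ℝ → ℝ) (n : ℕ) (s : ℝ) :
    g^[n] (p + σ * s) = p + σ * (chart p σ g)^[n] s := by
  induction n with
  | zero => rfl
  | succ n ih => rw [Function.iterate_succ_apply', Function.iterate_succ_apply', ih,
      h.chart_semiconj]

theorem iterDeriv_chart (h : OrientedComponent a b f c d p σ) (g g₁ : ℝ → ℝ) (n : ℕ) (s : ℝ) :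
    iterDeriv g g₁ n (p + σ * s) = iterDeriv (chart p σ g) (fun s => g₁ (p + σ * s)) n s :=
  Finset.prod_congr rfl fun i _ => by rw [h.iterate_chart]

theorem abs_disp_chart (h : OrientedComponent a b f c d p σ) (g : ℝ → ℝ) (s : ℝ) :
    |disp (chart p σ g) s| = |p + σ * s - g (p + σ * s)| := by
  have e : disp (chart p σ g) s = σ * (p + σ * s - g (p + σ * s)) := by
    have := h.sq
    rw [disp, chart]
    linear_combination -s * this
  have hσ : |σ| = 1 := by
    rcases h.endpoint with ⟨rfl, -⟩ | ⟨rfl, -⟩ <;> simp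
  rw [e, abs_mul, hσ, one_mul]

end OrientedComponent

namespace IsComponent

variable {a b c d : ℝ} {f : ℝ → ℝ}

theorem mapsTo_Ioo (h : IsComponent a b f c d) (hf : IsC2Diffeo a b f) :
    MapsTo f (Ioo c d) (Ioo c d) := by
  intro x hx
  have hx' := h.subset (Ioo_subset_Icc_self hx)
  have h1 := hf.strictMonoOn (h.subset (left_mem_Icc.2 h.lt.le)) hx' hx.1
  have h2 := hf.strictMonoOn hx' (h.subset (right_mem_Icc.2 h.lt.le)) hx.2
  rw [h.fixed_left] at h1
  rw [h.fixed_right] at h2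
  exact ⟨h1, h2⟩

theorem inverse (h : IsComponent a b f c d) (hf : IsC2Diffeo a b f) :
    IsComponent a b (inverse a b f) c d where
  lt := h.lt
  subset := h.subset
  fixed_left := (hf.inverse_eq_self_iff (h.subset (left_mem_Icc.2 h.lt.le))).2 h.fixed_left
  fixed_right := (hf.inverse_eq_self_iff (h.subset (right_mem_Icc.2 h.lt.le))).2 h.fixed_right
  ne_of_mem_interior x hx := fun he => h.ne_of_mem_interior x hx
    ((hf.inverse_eq_self_iff (h.subset (Ioo_subset_Icc_self hx))).1 he)

/-- Without interior fixed points the displacement has constant sign, and that sign decides which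
endpoint repels. -/
theorem exists_orientedComponent (h : IsComponent a b f c d) (hf : IsC2Diffeo a b f) :
    ∃ p σ, OrientedComponent a b f c d p σ := by
  have hc : ContinuousOn (fun x => f x - x) (Ioo c d) :=
    (hf.contDiffOn.continuousOn.mono (Ioo_subset_Icc_self.trans h.subset)).sub continuousOn_id
  by_cases hpos : ∀ x ∈ Ioo c d, x < f x
  · exact ⟨c, 1, h, Or.inl ⟨rfl, rfl⟩, fun x hx => by linarith [hpos x hx]⟩
  · push Not at hpos
    obtain ⟨x, hx, hfx⟩ := hpos
    refine ⟨d, -1, h, Or.inr ⟨rfl, rfl⟩, fun y hy => ?_⟩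
    by_contra hneg
    obtain ⟨z, hz, hz0⟩ := isPreconnected_Ioo.intermediate_value hx hy hc
      ⟨show f x - x ≤ 0 by linarith, show 0 ≤ f y - y by linarith⟩
    exact h.ne_of_mem_interior z hz (sub_eq_zero.1 hz0)

end IsComponent

namespace OrientedComponent

variable {a b c d p σ : ℝ} {f : ℝ → ℝ}

theorem isRepellingEndpoint (h : OrientedComponent a b f c d p σ) :
    IsRepellingEndpoint f c d p := by
  refine ⟨h.endpoint.imp And.right And.right, fun x hx => ?_⟩
  have h1 := h.pos x hx
  rcases h.endpoint with ⟨rfl, rfl⟩ | ⟨rfl, rfl⟩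
  · rw [abs_of_pos (by linarith [hx.1]), abs_of_pos (by linarith [hx.1])]
    linarith
  · rw [abs_of_neg (by linarith [hx.2]), abs_of_neg (by linarith [hx.2])]
    linarith

theorem eq_of_isRepellingEndpoint (h : OrientedComponent a b f c d p σ) (hf : IsC2Diffeo a b f)
    {r : ℝ} (hr : IsRepellingEndpoint f c d r) : r = p := by
  have hcd := h.isComponent.lt
  have hx : (c + d) / 2 ∈ Ioo c d := ⟨by linarith, by linarith⟩
  have h1 := h.pos _ hx
  have h2 := hr.2 _ hx
  have hfx := h.isComponent.mapsTo_Ioo hf hx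
  generalize (c + d) / 2 = x at *
  rcases h.endpoint with ⟨rfl, rfl⟩ | ⟨rfl, rfl⟩ <;> rcases hr.1 with rfl | rfl
  · rfl
  · rw [abs_of_neg (by linarith [hx.2]), abs_of_neg (by linarith [hfx.2])] at h2
    linarith
  · rw [abs_of_pos (by linarith [hx.1]), abs_of_pos (by linarith [hfx.1])] at h2
    linarith
  · rfl

/-- The constant `C` is an input rather than a witness, so that a single `C`, coming from the whole
of `[a, b]`, serves every component. -/
theorem parabolicContraction (h : OrientedComponent a b f c d p σ) (hab : a < b)
    (hf : IsC2Diffeo a b f) (hpar : OnlyParabolicFixedPoints a b f) {C : ℝ} (hC : b - a ≤ C)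
    (hb : ∀ x ∈ Icc a b, 1 ≤ C * derivWithin (inverse a b f) (Icc a b) x ∧
      |secondDeriv a b (inverse a b f) x| ≤ C ∧
      |secondDeriv a b (inverse a b f) x| ≤ C * derivWithin (inverse a b f) (Icc a b) x) :
    ParabolicContraction C (d - c) (chart p σ (inverse a b f))
      (fun s => derivWithin (inverse a b f) (Icc a b) (p + σ * s))
      (fun s => σ * secondDeriv a b (inverse a b f) (p + σ * s)) := by
  have hI := h.isComponent
  have hcd := hI.lt
  have hg := hf.inverse
  have hpg := hf.derivWithin_inverse_of_fixed hab hpar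
  have hsub := hI.subset
  have hmem : ∀ s ∈ Icc 0 (d - c), p + σ * s ∈ Icc a b := fun s hs =>
    hsub ((h.affine_mem_Icc_iff s).1 hs)
  have hσ : |σ| = 1 := by
    rcases h.endpoint with ⟨rfl, -⟩ | ⟨rfl, -⟩ <;> simp
  have hIg := hI.inverse hf
  have hcont : ContinuousOn (fun s : ℝ => p + σ * s) (Icc 0 (d - c)) := by fun_prop
  have hnhds : ∀ s ∈ Ioo 0 (d - c), Icc a b ∈ 𝓝 (p + σ * s) := fun s hs =>
    mem_of_superset (isOpen_Ioo.mem_nhds ((h.affine_mem_Ioo_iff s).1 hs))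
      (Ioo_subset_Icc_self.trans hsub)
  have haff : ∀ s : ℝ, HasDerivAt (fun s : ℝ => p + σ * s) σ s := fun s => by
    simpa using ((hasDerivAt_id s).const_mul σ).const_add p
  refine
  { pos := by linarith
    le := ?_
    map_zero := ?_
    map_right := ?_
    lt_self := ?_
    continuousOn := ?_
    continuousOn₁ := (hg.contDiffOn_derivWithin hab).continuousOn.comp hcont hmem
    continuousOn₂ :=
      continuousOn_const.mul ((hg.continuousOn_secondDeriv hab).comp hcont hmem)
    hasDerivAt := ?_
    hasDerivAt₁ := ?_
    deriv_zero := ?_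
    deriv_right := ?_
    one_le := fun x hx => (hb _ (hmem x hx)).1
    abs_deriv₂_le := fun x hx => ?_
    abs_deriv₂_le_mul := fun x hx => ?_ }
  · have h1 := (hsub (left_mem_Icc.2 hcd.le)).1
    have h2 := (hsub (right_mem_Icc.2 hcd.le)).2
    linarith
  · rw [chart, mul_zero, add_zero, (hf.inverse_eq_self_iff h.mem_Icc).2 h.fixed, sub_self, mul_zero]
  · rcases h.endpoint with ⟨rfl, rfl⟩ | ⟨rfl, rfl⟩
    · simp [chart, hIg.fixed_right]
    · simp [chart, hIg.fixed_left]
  · intro s hs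
    have hy := hIg.mapsTo_Ioo hg ((h.affine_mem_Ioo_iff s).1 hs)
    have h1 := h.pos _ hy
    rw [hf.apply_inverse (hmem s (Ioo_subset_Icc_self hs))] at h1
    rw [← sub_pos]
    refine h1.trans_eq ?_
    rw [chart]
    linear_combination s * h.sq
  · exact continuousOn_const.mul
      ((hg.contDiffOn.continuousOn.comp hcont hmem).sub continuousOn_const)
  · intro s hs
    have h1 := ((hg.hasDerivWithinAt (hmem s (Ioo_subset_Icc_self hs))).hasDerivAt
      (hnhds s hs)).comp s (haff s)
    have h2 := (h1.sub_const p).const_mul σ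
    refine h2.congr_deriv ?_
    linear_combination derivWithin (IntervalDiffeo.inverse a b f) (Icc a b) (p + σ * s) * h.sq
  · intro s hs
    have h1 := ((hg.hasDerivWithinAt₂ hab (hmem s (Ioo_subset_Icc_self hs))).hasDerivAt
      (hnhds s hs)).comp s (haff s)
    rw [mul_comm] at h1
    exact h1
  · simp only [mul_zero, add_zero]
    exact hpg p h.mem_Icc ((hf.inverse_eq_self_iff h.mem_Icc).2 h.fixed)
  · have hm := hmem (d - c) (right_mem_Icc.2 (by linarith))
    refine hpg _ hm ?_
    rcases h.endpoint with ⟨rfl, rfl⟩ | ⟨rfl, rfl⟩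
    · simp [hIg.fixed_right]
    · simp [hIg.fixed_left]
  · rw [abs_mul, hσ, one_mul]
    exact (hb _ (hmem x hx)).2.1
  · rw [abs_mul, hσ, one_mul]
    exact (hb _ (hmem x hx)).2.2

theorem isRightInverseOn (h : OrientedComponent a b f c d p σ) (hf : IsC2Diffeo a b f) :
    IsRightInverseOn (d - c) (chart p σ (inverse a b f)) (chart p σ f) where
  map_zero := by rw [chart, mul_zero, add_zero, h.fixed, sub_self, mul_zero]
  mem s hs := by
    rw [h.affine_mem_Ioo_iff, h.chart_semiconj]
    exact h.isComponent.mapsTo_Ioo hf ((h.affine_mem_Ioo_iff s).1 hs)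
  apply s hs := by
    have hs' := (h.affine_mem_Ioo_iff s).1 hs
    rw [chart, h.chart_semiconj,
      hf.inverse_apply (h.isComponent.subset (Ioo_subset_Icc_self hs')), add_sub_cancel_left,
      ← mul_assoc, h.sq, one_mul]

/-- The Szekeres vector field on a component. -/
noncomputable def field (a b : ℝ) (f : ℝ → ℝ) (c d p σ : ℝ) (x : ℝ) : ℝ :=
  σ * szekeres (d - c) (chart p σ (inverse a b f))
    (fun s => derivWithin (inverse a b f) (Icc a b) (p + σ * s)) (-(σ * p) + σ * x)

theorem isSzekeresField_field (h : OrientedComponent a b f c d p σ) (hab : a < b)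
    (hf : IsC2Diffeo a b f) (hpar : OnlyParabolicFixedPoints a b f) :
    IsSzekeresField f c d p (field a b f c d p σ) := by
  obtain ⟨C, hC, hb⟩ := hf.inverse.exists_bound hab
  have hP := h.parabolicContraction hab hf hpar hC hb
  have hS : ∀ x, x ∈ halfClosed c d p ↔ -(σ * p) + σ * x ∈ Ico 0 (d - c) := fun x => by
    rw [h.affine_mem_halfClosed_iff, h.affine_inv']
  refine ⟨contDiffOn_comp_affine _ hS hP.contDiffOn_szekeres, ?_⟩
  have := (hP.isTimeOneMap_szekeres (h.isRightInverseOn hf)).comp_affine h.sq _ hS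
  -- The second chart undoes the first.
  have e : chart (-(σ * p)) σ (chart p σ f) = f := by
    funext x
    rw [chart, chart, h.affine_inv']
    linear_combination (f x) * h.sq
  rwa [e] at this

theorem continuousOn_field (h : OrientedComponent a b f c d p σ) (hab : a < b)
    (hf : IsC2Diffeo a b f) (hpar : OnlyParabolicFixedPoints a b f) :
    ContinuousOn (field a b f c d p σ) (Icc c d) := by
  obtain ⟨C, hC, hb⟩ := hf.inverse.exists_bound hab
  have hP := h.parabolicContraction hab hf hpar hC hb
  refine continuousOn_const.mul (hP.continuousOn_szekeres.comp (by fun_prop) fun x hx => ?_)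
  rw [h.affine_mem_Icc_iff, h.affine_inv']
  exact hx

theorem eqOn_field (h : OrientedComponent a b f c d p σ) (hab : a < b)
    (hf : IsC2Diffeo a b f) (hpar : OnlyParabolicFixedPoints a b f) {Y : ℝ → ℝ}
    (hY : IsSzekeresField f c d p Y) : EqOn Y (field a b f c d p σ) (halfClosed c d p) := by
  obtain ⟨C, hC, hb⟩ := hf.inverse.exists_bound hab
  have hP := h.parabolicContraction hab hf hpar hC hb
  intro x hx
  have hx' : -(σ * p) + σ * x ∈ Ico 0 (d - c) := by
    rwa [h.affine_mem_halfClosed_iff, h.affine_inv']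
  have := hP.eqOn_szekeres (h.isRightInverseOn hf)
    (contDiffOn_comp_affine p h.affine_mem_halfClosed_iff hY.contDiffOn)
    (hY.isTimeOneMap.comp_affine h.sq p h.affine_mem_halfClosed_iff) hx'
  simp only [h.affine_inv'] at this
  rw [field, ← this, ← mul_assoc, h.sq, one_mul]

/-- Uniqueness on the half-closed interval passes to the remaining endpoint by density and
continuity, so the maximum in `growthValues` does not depend on the chosen field. -/
theorem eqOn_field_Icc (h : OrientedComponent a b f c d p σ) (hab : a < b)
    (hf : IsC2Diffeo a b f) (hpar : OnlyParabolicFixedPoints a b f) {Y : ℝ → ℝ}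
    (hY : IsSzekeresField f c d p Y) (hYc : ContinuousOn Y (Icc c d)) :
    EqOn Y (field a b f c d p σ) (Icc c d) := by
  refine ((h.eqOn_field hab hf hpar hY).mono subset_union_left).of_subset_closure hYc
    (h.continuousOn_field hab hf hpar) Ioo_subset_Icc_self ?_
  rw [closure_Ioo h.isComponent.lt.ne]

theorem abs_field (h : OrientedComponent a b f c d p σ) (s : ℝ) :
    |field a b f c d p σ (p + σ * s)| = szekeres (d - c) (chart p σ (inverse a b f))
      (fun s => derivWithin (inverse a b f) (Icc a b) (p + σ * s)) s := by
  have hσ : |σ| = 1 := by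
    rcases h.endpoint with ⟨rfl, -⟩ | ⟨rfl, -⟩ <;> simp
  have e : -(σ * p) + σ * (p + σ * s) = s := by linear_combination s * h.sq
  rw [field, e, abs_mul, hσ, one_mul, abs_of_nonneg (ParabolicContraction.szekeres_nonneg s)]

end OrientedComponent

variable {a b c d p σ : ℝ} {f : ℝ → ℝ}

namespace OrientedComponent

theorem field_eq_zero (h : OrientedComponent a b f c d p σ) {x : ℝ} (hx : x ∉ Ioo c d) :
    field a b f c d p σ x = 0 := by
  rw [field, szekeres, indicator_of_notMem, mul_zero]
  rwa [h.affine_mem_Ioo_iff, h.affine_inv']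

theorem field_ne_zero (h : OrientedComponent a b f c d p σ) {x : ℝ} (hx : x ∈ Ioo c d) :
    field a b f c d p σ x ≠ 0 := by
  rw [← abs_pos, ← h.affine_inv x, h.abs_field]
  apply ParabolicContraction.szekeres_pos
  rwa [h.affine_mem_Ioo_iff, h.affine_inv]

theorem exists_isGreatest (h : OrientedComponent a b f c d p σ) (hab : a < b)
    (hf : IsC2Diffeo a b f) (hpar : OnlyParabolicFixedPoints a b f) :
    ∃ M, IsGreatest ((fun y => |field a b f c d p σ y|) '' Icc c d) M :=
  (isCompact_Icc.image_of_continuousOn (h.continuousOn_field hab hf hpar).abs).exists_isGreatest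
    ((nonempty_Icc.2 h.isComponent.lt.le).image _)

theorem mem_growthValues (h : OrientedComponent a b f c d p σ) (hab : a < b)
    (hf : IsC2Diffeo a b f) (hpar : OnlyParabolicFixedPoints a b f) {M : ℝ}
    (hM : IsGreatest ((fun y => |field a b f c d p σ y|) '' Icc c d) M) :
    1 / 2 * |secondDeriv a b f p| * M ∈ growthValues a b f :=
  ⟨c, d, p, field a b f c d p σ, M, h.isComponent, h.isRepellingEndpoint,
    h.isSzekeresField_field hab hf hpar, h.continuousOn_field hab hf hpar, hM, rfl⟩

theorem exists_le_growthValue (h : OrientedComponent a b f c d p σ) (hab : a < b)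
    (hf : IsC2Diffeo a b f) (hpar : OnlyParabolicFixedPoints a b f) {x : ℝ} (hx : x ∈ Icc c d) :
    ∃ v ∈ growthValues a b f, 1 / 2 * |secondDeriv a b f p| * |field a b f c d p σ x| ≤ v := by
  obtain ⟨M, hM⟩ := h.exists_isGreatest hab hf hpar
  refine ⟨_, h.mem_growthValues hab hf hpar hM, ?_⟩
  gcongr
  exact hM.2 ⟨x, hx, rfl⟩

theorem abs_secondDeriv_inverse (h : OrientedComponent a b f c d p σ) (hab : a < b)
    (hf : IsC2Diffeo a b f) (hpar : OnlyParabolicFixedPoints a b f) :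
    |secondDeriv a b (inverse a b f) p| = |secondDeriv a b f p| := by
  rw [hf.secondDeriv_inverse_of_fixed hab hpar h.mem_Icc h.fixed, abs_neg]

/-- The growth of the derivatives of the iterates on a component, locally uniformly. -/
theorem tendsto_inv_iterDeriv_div_sq (h : OrientedComponent a b f c d p σ) (hab : a < b)
    (hf : IsC2Diffeo a b f) (hpar : OnlyParabolicFixedPoints a b f) {y₀ : ℝ}
    (hy : y₀ ∈ Ioo c d) :
    Tendsto (fun q : ℕ × ℝ => (iterDeriv (inverse a b f)
        (derivWithin (inverse a b f) (Icc a b)) q.1 q.2)⁻¹ / (q.1 : ℝ) ^ 2) (atTop ×ˢ 𝓝 y₀)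
      (𝓝 (1 / 2 * |secondDeriv a b f p| * |field a b f c d p σ y₀|)) := by
  obtain ⟨C, hC, hb⟩ := hf.inverse.exists_bound hab
  have hP := h.parabolicContraction hab hf hpar hC hb
  have hs : σ * (y₀ - p) ∈ Ioo 0 (d - c) := by
    rwa [h.affine_mem_Ioo_iff, h.affine_inv]
  have h1 := hP.tendsto_inv_iterDeriv_div_sq hs
  have hσ : |σ| = 1 := by
    rcases h.endpoint with ⟨rfl, -⟩ | ⟨rfl, -⟩ <;> simp
  have h2 : -(σ * secondDeriv a b (inverse a b f) (p + σ * 0)) / 2 =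
      1 / 2 * |secondDeriv a b f p| := by
    -- The displacement is nonnegative, so the second derivative of the contraction at `0` is
    -- nonpositive; this fixes the sign and produces the absolute value.
    have h3 := abs_of_nonpos hP.deriv₂_zero_nonpos
    rw [abs_mul, hσ, one_mul] at h3
    rw [← h3, mul_zero, add_zero, h.abs_secondDeriv_inverse hab hf hpar]
    ring
  rw [h2, ← h.abs_field, h.affine_inv] at h1
  have h4 : Tendsto (fun x : ℝ => σ * (x - p)) (𝓝 y₀) (𝓝 (σ * (y₀ - p))) :=
    Continuous.tendsto (by fun_prop) y₀
  refine (h1.comp (tendsto_id.prodMap h4)).congr fun q => ?_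
  simp only [Function.comp, Prod.map, id]
  rw [← h.iterDeriv_chart, h.affine_inv]

theorem inv_iterDeriv_le (h : OrientedComponent a b f c d p σ) (hab : a < b)
    (hf : IsC2Diffeo a b f) (hpar : OnlyParabolicFixedPoints a b f) {C : ℝ} (hC : b - a ≤ C)
    (hb : ∀ x ∈ Icc a b, 1 ≤ C * derivWithin (inverse a b f) (Icc a b) x ∧
      |secondDeriv a b (inverse a b f) x| ≤ C ∧
      |secondDeriv a b (inverse a b f) x| ≤ C * derivWithin (inverse a b f) (Icc a b) x) {y : ℝ}
    (hy : y ∈ Ioo c d) (n : ℕ) :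
    (iterDeriv (inverse a b f) (derivWithin (inverse a b f) (Icc a b)) n y)⁻¹ ≤
      2 * Real.exp (C * C) ^ 2 *
        (1 + (2 * C + C ^ 2) ^ 2 * (n ^ 2 * |y - inverse a b f y|)) := by
  have hP := h.parabolicContraction hab hf hpar hC hb
  have hs : σ * (y - p) ∈ Ioo 0 (d - c) := by
    rwa [h.affine_mem_Ioo_iff, h.affine_inv]
  have h1 := hP.inv_iterDeriv_le hs n
  rwa [← h.iterDeriv_chart, ← abs_of_pos (hP.disp_pos hs), h.abs_disp_chart, h.affine_inv] at h1

theorem growthValue_le (h : OrientedComponent a b f c d p σ) (hab : a < b)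
    (hf : IsC2Diffeo a b f) (hpar : OnlyParabolicFixedPoints a b f) {C : ℝ} (hC : b - a ≤ C)
    (hb : ∀ x ∈ Icc a b, 1 ≤ C * derivWithin (inverse a b f) (Icc a b) x ∧
      |secondDeriv a b (inverse a b f) x| ≤ C ∧
      |secondDeriv a b (inverse a b f) x| ≤ C * derivWithin (inverse a b f) (Icc a b) x)
    (x : ℝ) :
    1 / 2 * |secondDeriv a b f p| * |field a b f c d p σ x| ≤
      1 / 2 * C * (Real.exp (C * C) * C) := by
  have hP := h.parabolicContraction hab hf hpar hC hb
  have hC0 := hP.C_pos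
  gcongr
  · rw [← h.abs_secondDeriv_inverse hab hf hpar]
    exact (hb p h.mem_Icc).2.1
  · by_cases hx' : x ∈ Ioo c d
    · have hs : σ * (x - p) ∈ Ioo 0 (d - c) := by
        rwa [h.affine_mem_Ioo_iff, h.affine_inv]
      rw [← h.affine_inv x, h.abs_field]
      refine (hP.szekeres_le' hs).trans ?_
      gcongr
      exact (hP.disp_le_self hs).trans (hs.2.le.trans hP.le)
    · rw [h.field_eq_zero hx', abs_zero]
      positivity

end OrientedComponent

/-! ### Growth on the whole interval. -/

namespace IsC2Diffeo

theorem mem_growthValues_iff (hf : IsC2Diffeo a b f) (hab : a < b)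
    (hpar : OnlyParabolicFixedPoints a b f) {v : ℝ} :
    v ∈ growthValues a b f ↔ ∃ c d p σ M, OrientedComponent a b f c d p σ ∧
      IsGreatest ((fun y => |OrientedComponent.field a b f c d p σ y|) '' Icc c d) M ∧
      v = 1 / 2 * |secondDeriv a b f p| * M := by
  constructor
  · rintro ⟨c, d, r, X, M, hI, hr, hX, hXc, hM, rfl⟩
    obtain ⟨p, σ, ho⟩ := hI.exists_orientedComponent hf
    obtain rfl := ho.eq_of_isRepellingEndpoint hf hr
    refine ⟨c, d, r, σ, M, ho, ?_, rfl⟩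
    rwa [image_congr fun y hy => by rw [ho.eqOn_field_Icc hab hf hpar hX hXc hy]] at hM
  · rintro ⟨c, d, p, σ, M, ho, hM, rfl⟩
    exact ho.mem_growthValues hab hf hpar hM

theorem growthValues_nonneg {v : ℝ} (hv : v ∈ growthValues a b f) : 0 ≤ v := by
  obtain ⟨c, d, r, X, M, -, -, -, -, ⟨⟨y, -, hy⟩, -⟩, rfl⟩ := hv
  rw [← hy]
  positivity

theorem growthValues_nonempty (hf : IsC2Diffeo a b f) (hab : a < b)
    (hpar : OnlyParabolicFixedPoints a b f) (hne : ∃ x ∈ Icc a b, f x ≠ x) :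
    (growthValues a b f).Nonempty := by
  obtain ⟨x, hx, hfx⟩ := hne
  obtain ⟨c, d, hI, -⟩ := hf.exists_isComponent hx hfx
  obtain ⟨p, σ, ho⟩ := hI.exists_orientedComponent hf
  obtain ⟨M, hM⟩ := ho.exists_isGreatest hab hf hpar
  exact ⟨_, ho.mem_growthValues hab hf hpar hM⟩

theorem bddAbove_growthValues (hf : IsC2Diffeo a b f) (hab : a < b)
    (hpar : OnlyParabolicFixedPoints a b f) : BddAbove (growthValues a b f) := by
  obtain ⟨C, hC, hb⟩ := hf.inverse.exists_bound hab
  refine ⟨1 / 2 * C * (Real.exp (C * C) * C), fun v hv => ?_⟩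
  obtain ⟨c, d, p, σ, M, ho, ⟨⟨y, -, rfl⟩, -⟩, rfl⟩ := (hf.mem_growthValues_iff hab hpar).1 hv
  exact ho.growthValue_le hab hf hpar hC hb y

theorem iterDeriv_inverse_of_fixed (hf : IsC2Diffeo a b f) (hab : a < b)
    (hpar : OnlyParabolicFixedPoints a b f) {y : ℝ} (hy : y ∈ Icc a b) (hfy : f y = y) (n : ℕ) :
    iterDeriv (IntervalDiffeo.inverse a b f)
      (derivWithin (IntervalDiffeo.inverse a b f) (Icc a b)) n y = 1 := by
  have hgy := (hf.inverse_eq_self_iff hy).2 hfy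
  refine Finset.prod_eq_one fun i _ => ?_
  rw [Function.iterate_fixed hgy]
  exact hf.derivWithin_inverse_of_fixed hab hpar y hy hgy

/-- The estimate on a single component has constants depending on `C` only, and at fixed points the
derivative is `1`, so one constant works for all points. -/
theorem exists_inv_iterDeriv_le (hf : IsC2Diffeo a b f) (hab : a < b)
    (hpar : OnlyParabolicFixedPoints a b f) :
    ∃ K, 0 < K ∧ ∀ y ∈ Icc a b, ∀ n : ℕ,
      (iterDeriv (IntervalDiffeo.inverse a b f)
        (derivWithin (IntervalDiffeo.inverse a b f) (Icc a b)) n y)⁻¹ ≤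
        K * (1 + n ^ 2 * |y - IntervalDiffeo.inverse a b f y|) := by
  obtain ⟨C, hC, hb⟩ := hf.inverse.exists_bound hab
  have hC0 : 0 < C := (sub_pos.2 hab).trans_le hC
  set A := 2 * Real.exp (C * C) ^ 2 with hA
  set B := (2 * C + C ^ 2) ^ 2 with hB
  have hA0 : 0 < A := by positivity
  have hB0 : 0 < B := by positivity
  refine ⟨A * (1 + B) + 1, by positivity, fun y hy n => ?_⟩
  have hn : 0 ≤ (n : ℝ) ^ 2 * |y - IntervalDiffeo.inverse a b f y| := by positivity
  by_cases hfy : f y = y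
  · rw [hf.iterDeriv_inverse_of_fixed hab hpar hy hfy, inv_one]
    nlinarith [mul_pos hA0 hB0]
  · obtain ⟨c, d, hI, hyI⟩ := hf.exists_isComponent hy hfy
    obtain ⟨p, σ, ho⟩ := hI.exists_orientedComponent hf
    refine (ho.inv_iterDeriv_le hab hf hpar hC hb hyI n).trans ?_
    rw [← hA, ← hB]
    nlinarith [mul_pos hA0 hB0, mul_nonneg hA0.le hn]

/-- The local limits are at most `l` but are uniform only near each nonfixed point. The a priori
bound takes care of a neighbourhood of the fixed set, and compactness of the rest. -/
theorem eventually_inv_iterDeriv_div_sq_le (hf : IsC2Diffeo a b f) (hab : a < b)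
    (hpar : OnlyParabolicFixedPoints a b f) {l : ℝ} (hl : l ∈ upperBounds (growthValues a b f))
    (hl0 : 0 ≤ l) {ε : ℝ} (hε : 0 < ε) :
    ∀ᶠ n : ℕ in atTop, ∀ y ∈ Icc a b, (iterDeriv (IntervalDiffeo.inverse a b f)
        (derivWithin (IntervalDiffeo.inverse a b f) (Icc a b)) n y)⁻¹ / (n : ℝ) ^ 2 ≤ l + ε := by
  obtain ⟨K, hK, hbound⟩ := hf.exists_inv_iterDeriv_le hab hpar
  set g := IntervalDiffeo.inverse a b f
  -- With this threshold the term `K * |y - g y|` is at most `ε / 2`; the remaining `K / n ^ 2` is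
  -- below `ε / 2` once `n ^ 2` exceeds `2 * K / ε`.
  set η := ε / (2 * K)
  have hη : 0 < η := by positivity
  have hcg : ContinuousOn (fun y => |y - g y|) (Icc a b) :=
    (continuousOn_id.sub hf.contDiffOn_inverse.continuousOn).abs
  have hcpt : IsCompact {y ∈ Icc a b | η ≤ |y - g y|} :=
    isCompact_Icc.of_isClosed_subset
      (hcg.preimage_isClosed_of_isClosed isClosed_Icc isClosed_Ici) (sep_subset _ _)
  have hfar : ∀ᶠ n : ℕ in atTop, ∀ y ∈ {y ∈ Icc a b | η ≤ |y - g y|},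
      (iterDeriv g (derivWithin g (Icc a b)) n y)⁻¹ / (n : ℝ) ^ 2 ≤ l + ε := by
    refine hcpt.induction_on (p := fun S => ∀ᶠ n : ℕ in atTop, ∀ y ∈ S,
      (iterDeriv g (derivWithin g (Icc a b)) n y)⁻¹ / (n : ℝ) ^ 2 ≤ l + ε) (by simp)
      (fun s t hst ht => ht.mono fun n hn y hy => hn y (hst hy))
      (fun s t hs ht => (hs.and ht).mono fun n hn y hy => hy.elim (hn.1 y) (hn.2 y)) ?_
    rintro y ⟨hy, hyη⟩
    have hfy : f y ≠ y := by
      intro he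
      have : g y = y := (hf.inverse_eq_self_iff hy).2 he
      rw [this, sub_self, abs_zero] at hyη
      linarith
    obtain ⟨c, d, hI, hyI⟩ := hf.exists_isComponent hy hfy
    obtain ⟨p, σ, ho⟩ := hI.exists_orientedComponent hf
    obtain ⟨v, hv, hle⟩ := ho.exists_le_growthValue hab hf hpar (Ioo_subset_Icc_self hyI)
    have hlt : 1 / 2 * |secondDeriv a b f p| * |OrientedComponent.field a b f c d p σ y| < l + ε :=
      by linarith [hl hv]
    have hev := (ho.tendsto_inv_iterDeriv_div_sq hab hf hpar hyI).eventually (gt_mem_nhds hlt)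
    obtain ⟨pa, ha, pb, hb, hab'⟩ := eventually_prod_iff.1 hev
    exact ⟨{z | pb z}, mem_nhdsWithin_of_mem_nhds hb,
      ha.mono fun n hn z hz => (hab' hn hz).le⟩
  have hbig : ∀ᶠ n : ℕ in atTop, 2 * K / ε < (n : ℝ) ^ 2 :=
    ((tendsto_pow_atTop two_ne_zero).comp
      (tendsto_natCast_atTop_atTop (R := ℝ))).eventually_gt_atTop _
  filter_upwards [hfar, hbig] with n hn hnb y hy
  by_cases hyη : η ≤ |y - g y|
  · exact hn y ⟨hy, hyη⟩
  · rw [not_le] at hyη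
    have hn0 : 0 < (n : ℝ) ^ 2 := lt_trans (by positivity) hnb
    rw [div_lt_iff₀ hε] at hnb
    rw [div_le_iff₀ hn0]
    refine (hbound y hy n).trans ?_
    have h1 : K * |y - g y| ≤ ε / 2 := by
      calc K * |y - g y| ≤ K * η := by gcongr
        _ = ε / 2 := by simp only [η]; field_simp
    have h2 : K * |y - g y| * (n : ℝ) ^ 2 ≤ ε / 2 * (n : ℝ) ^ 2 := by gcongr
    nlinarith [mul_nonneg hl0 hn0.le]

theorem bddAbove_derivWithin_iterate (hf : IsC2Diffeo a b f) (hab : a < b) (n : ℕ) :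
    BddAbove ((fun x => derivWithin (f^[n]) (Icc a b) x) '' Icc a b) :=
  isCompact_Icc.bddAbove_image (hf.continuousOn_derivWithin_iterate hab n)

theorem derivWithin_iterate_le_gammaPlus (hf : IsC2Diffeo a b f) (hab : a < b) {x : ℝ}
    (hx : x ∈ Icc a b) (n : ℕ) : derivWithin (f^[n]) (Icc a b) x ≤ gammaPlus a b f n :=
  le_csSup (hf.bddAbove_derivWithin_iterate hab n) ⟨x, hx, rfl⟩

/-- The iterate is a bijection of `[a, b]`, so its derivative may be indexed by the end point of the
orbit segment instead of its starting point. -/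
theorem inv_iterDeriv_le_gammaPlus (hf : IsC2Diffeo a b f) (hab : a < b) {y : ℝ}
    (hy : y ∈ Icc a b) (n : ℕ) :
    (iterDeriv (IntervalDiffeo.inverse a b f)
      (derivWithin (IntervalDiffeo.inverse a b f) (Icc a b)) n y)⁻¹ ≤ gammaPlus a b f n := by
  have hx := hf.inverse.iterate_mem hy n
  have h1 := hf.derivWithin_iterate_le_gammaPlus hab hx n
  rwa [hf.derivWithin_iterate_eq_inv hab hx, hf.iterate_inverse_iterate hy] at h1

theorem gammaPlus_nonneg (hf : IsC2Diffeo a b f) (hab : a < b) (n : ℕ) :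
    0 ≤ gammaPlus a b f n := by
  refine Real.sSup_nonneg ?_
  rintro _ ⟨x, hx, rfl⟩
  exact (Finset.prod_nonneg fun i _ => (hf.derivWithin_pos hab (hf.iterate_mem hx i)).le).trans_eq
    (hf.derivWithin_iterate hab hx n).symm

theorem tendsto_gammaPlus (hf : IsC2Diffeo a b f) (hab : a < b)
    (hpar : OnlyParabolicFixedPoints a b f) {l : ℝ} (hl : IsLUB (growthValues a b f) l)
    (hl0 : 0 ≤ l) :
    Tendsto (fun n : ℕ => gammaPlus a b f n / (n : ℝ) ^ 2) atTop (𝓝 l) := by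
  refine tendsto_order.2 ⟨fun u hu => ?_, fun u hu => ?_⟩
  · obtain ⟨v, hv, huv⟩ := (lt_isLUB_iff hl).1 hu
    obtain ⟨c, d, p, σ, M, ho, ⟨⟨y, hy, rfl⟩, -⟩, rfl⟩ := (hf.mem_growthValues_iff hab hpar).1 hv
    -- If the maximum is attained at an interior point, the limit at that single point gives the
    -- lower bound. At an endpoint the field vanishes, so `u` is negative and nonnegativity is
    -- enough.
    by_cases hy' : y ∈ Ioo c d
    · have h1 := (ho.tendsto_inv_iterDeriv_div_sq hab hf hpar hy').comp
        (tendsto_id.prodMk (tendsto_const_nhds (x := y)))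
      filter_upwards [h1.eventually (lt_mem_nhds huv)] with n hn
      refine hn.trans_le ?_
      simp only [Function.comp, id]
      gcongr
      exact hf.inv_iterDeriv_le_gammaPlus hab (ho.isComponent.subset hy) n
    · simp only [ho.field_eq_zero hy', abs_zero, mul_zero] at huv
      exact Eventually.of_forall fun n =>
        huv.trans_le (div_nonneg (hf.gammaPlus_nonneg hab n) (sq_nonneg _))
  · have hε : 0 < (u - l) / 2 := by linarith
    filter_upwards [hf.eventually_inv_iterDeriv_div_sq_le hab hpar hl.1 hl0 hε,
      eventually_gt_atTop 0] with n hn hn0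
    have hn0' : (0 : ℝ) < (n : ℝ) ^ 2 := by positivity
    refine lt_of_le_of_lt ?_ (show l + (u - l) / 2 < u by linarith)
    rw [div_le_iff₀ hn0']
    refine csSup_le ((nonempty_Icc.2 hab.le).image _) ?_
    rintro _ ⟨x, hx, rfl⟩
    have := hn _ (hf.iterate_mem hx n)
    rw [div_le_iff₀ hn0'] at this
    exact (hf.derivWithin_iterate_eq_inv hab hx n).trans_le this

/-- The quadratic growth of the derivatives of the positive iterates. -/
theorem exists_tendsto_gammaPlus (hf : IsC2Diffeo a b f) (hab : a < b)
    (hpar : OnlyParabolicFixedPoints a b f) (hne : ∃ x ∈ Icc a b, f x ≠ x) :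
    ∃ l : ℝ,
      Tendsto (fun n : ℕ => gammaPlus a b f n / (n : ℝ) ^ 2) atTop (𝓝 l) ∧
      IsLUB (growthValues a b f) l ∧
      ((∃ c d r : ℝ, IsComponent a b f c d ∧ IsRepellingEndpoint f c d r ∧
          secondDeriv a b f r ≠ 0) → 0 < l) ∧
      ((∀ c d r : ℝ, IsComponent a b f c d → IsRepellingEndpoint f c d r →
          secondDeriv a b f r = 0) → l = 0) := by
  have hne' := hf.growthValues_nonempty hab hpar hne
  have hl := isLUB_csSup hne' (hf.bddAbove_growthValues hab hpar)
  set l := sSup (growthValues a b f)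
  have hl0 : 0 ≤ l := by
    obtain ⟨v, hv⟩ := hne'
    exact (growthValues_nonneg hv).trans (hl.1 hv)
  refine ⟨l, hf.tendsto_gammaPlus hab hpar hl hl0, hl, ?_, fun h0 => ?_⟩
  · rintro ⟨c, d, r, hI, hr, hr0⟩
    obtain ⟨p, σ, ho⟩ := hI.exists_orientedComponent hf
    obtain rfl := ho.eq_of_isRepellingEndpoint hf hr
    have hcd := hI.lt
    have hx : (c + d) / 2 ∈ Ioo c d := ⟨by linarith, by linarith⟩
    obtain ⟨v, hv, hle⟩ := ho.exists_le_growthValue hab hf hpar (Ioo_subset_Icc_self hx)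
    refine lt_of_lt_of_le ?_ (hle.trans (hl.1 hv))
    have := abs_pos.2 hr0
    have := abs_pos.2 (ho.field_ne_zero hx)
    positivity
  -- All growth values are zero, so `0` is an upper bound and the least upper bound is at most `0`.
  · refine le_antisymm (hl.2 ?_) hl0
    rintro v ⟨c, d, r, X, M, hI, hr, -, -, -, rfl⟩
    simp [h0 c d r hI hr]

/-- The supremum of a pointwise maximum is the maximum of the suprema; the two-sided statement
thereby reduces to the one-sided one for `f` and for its inverse. -/
theorem gamma_eq_max (hf : IsC2Diffeo a b f) (hab : a < b) (n : ℕ) :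
    gamma a b f n = max (gammaPlus a b f n) (gammaPlus a b (IntervalDiffeo.inverse a b f) n) := by
  have hne : (Icc a b).Nonempty := nonempty_Icc.2 hab.le
  have h1 := fun {x} hx => hf.derivWithin_iterate_le_gammaPlus hab (x := x) hx n
  have h2 := fun {x} hx => hf.inverse.derivWithin_iterate_le_gammaPlus hab (x := x) hx n
  have hbdd : BddAbove ((fun x => max (derivWithin (f^[n]) (Icc a b) x)
      (derivWithin ((IntervalDiffeo.inverse a b f)^[n]) (Icc a b) x)) '' Icc a b) := by
    refine ⟨max (gammaPlus a b f n) (gammaPlus a b (IntervalDiffeo.inverse a b f) n), ?_⟩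
    rintro _ ⟨x, hx, rfl⟩
    exact max_le_max (h1 hx) (h2 hx)
  apply le_antisymm
  · refine csSup_le (hne.image _) ?_
    rintro _ ⟨x, hx, rfl⟩
    exact max_le_max (h1 hx) (h2 hx)
  · refine max_le (csSup_le (hne.image _) ?_) (csSup_le (hne.image _) ?_)
    · rintro _ ⟨x, hx, rfl⟩
      exact (le_max_left _ _).trans (le_csSup hbdd ⟨x, hx, rfl⟩)
    · rintro _ ⟨x, hx, rfl⟩
      exact (le_max_right _ _).trans (le_csSup hbdd ⟨x, hx, rfl⟩)

/-- The quadratic growth of the derivatives of the iterates of both signs. -/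
theorem exists_tendsto_gamma (hf : IsC2Diffeo a b f) (hab : a < b)
    (hpar : OnlyParabolicFixedPoints a b f) (hne : ∃ x ∈ Icc a b, f x ≠ x) :
    ∃ l : ℝ, Tendsto (fun n : ℕ => gamma a b f n / (n : ℝ) ^ 2) atTop (𝓝 l) ∧
      ((∀ x ∈ Icc a b, f x = x → secondDeriv a b f x = 0) → l = 0) := by
  obtain ⟨l₁, ht₁, -, -, h₁⟩ := hf.exists_tendsto_gammaPlus hab hpar hne
  obtain ⟨l₂, ht₂, -, -, h₂⟩ := hf.inverse.exists_tendsto_gammaPlus hab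
    (hf.derivWithin_inverse_of_fixed hab hpar)
    (by
      obtain ⟨x, hx, hfx⟩ := hne
      exact ⟨x, hx, fun h => hfx ((hf.inverse_eq_self_iff hx).1 h)⟩)
  refine ⟨max l₁ l₂, ?_, fun h0 => ?_⟩
  · refine (ht₁.max ht₂).congr fun n => ?_
    rw [hf.gamma_eq_max hab, max_div_div_right (sq_nonneg _)]
  · have key : ∀ {k : ℝ → ℝ} {c d r : ℝ}, IsComponent a b k c d → IsRepellingEndpoint k c d r →
        r ∈ Icc a b ∧ k r = r := by
      intro k c d r hI hr
      rcases hr.1 with rfl | rfl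
      · exact ⟨hI.subset (left_mem_Icc.2 hI.lt.le), hI.fixed_left⟩
      · exact ⟨hI.subset (right_mem_Icc.2 hI.lt.le), hI.fixed_right⟩
    have e₁ : l₁ = 0 := h₁ fun c d r hI hr => h0 r (key hI hr).1 (key hI hr).2
    have e₂ : l₂ = 0 := h₂ fun c d r hI hr => by
      obtain ⟨hm, hfix⟩ := key hI hr
      have hfr := (hf.inverse_eq_self_iff hm).1 hfix
      rw [hf.secondDeriv_inverse_of_fixed hab hpar hm hfr, h0 r hm hfr, neg_zero]
    rw [e₁, e₂, max_self]

end IsC2Diffeo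

end IntervalDiffeo

/-! ### The main theorem. -/

theorem mainTheorem1 (a b : ℝ) (hab : a < b) (f : ℝ → ℝ)
    (hf : IntervalDiffeo.IsC2Diffeo a b f)
    (hpar : IntervalDiffeo.OnlyParabolicFixedPoints a b f)
    (hne : ∃ x ∈ Icc a b, f x ≠ x) :
    -- on each component, the repelling endpoint and the Szekeres vector field are well defined,
    -- and the latter extends continuously to the closed component
    (∀ c d : ℝ, IntervalDiffeo.IsComponent a b f c d →
      (∃! r : ℝ, IntervalDiffeo.IsRepellingEndpoint f c d r) ∧
      ∀ r : ℝ, IntervalDiffeo.IsRepellingEndpoint f c d r →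
        ∃ X : ℝ → ℝ, IntervalDiffeo.IsSzekeresField f c d r X ∧ ContinuousOn X (Icc c d) ∧
          ∀ Y : ℝ → ℝ, IntervalDiffeo.IsSzekeresField f c d r Y →
            EqOn Y X (IntervalDiffeo.halfClosed c d r)) ∧
    -- the limit, its value, and when it vanishes
    (∃ ℓ : ℝ,
      Tendsto (fun n : ℕ => IntervalDiffeo.gammaPlus a b f n / (n : ℝ) ^ 2) atTop (𝓝 ℓ) ∧
      IsLUB (IntervalDiffeo.growthValues a b f) ℓ ∧
      ((∃ c d r : ℝ, IntervalDiffeo.IsComponent a b f c d ∧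
          IntervalDiffeo.IsRepellingEndpoint f c d r ∧
          IntervalDiffeo.secondDeriv a b f r ≠ 0) → 0 < ℓ) ∧
      ((∀ c d r : ℝ, IntervalDiffeo.IsComponent a b f c d →
          IntervalDiffeo.IsRepellingEndpoint f c d r →
          IntervalDiffeo.secondDeriv a b f r = 0) → ℓ = 0)) ∧
    -- iterates of both signs
    (∃ ℓ' : ℝ,
      Tendsto (fun n : ℕ => IntervalDiffeo.gamma a b f n / (n : ℝ) ^ 2) atTop (𝓝 ℓ') ∧
      ((∀ x ∈ Icc a b, f x = x → IntervalDiffeo.secondDeriv a b f x = 0) → ℓ' = 0)) := by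
  refine ⟨fun c d hI => ?_, hf.exists_tendsto_gammaPlus hab hpar hne,
    hf.exists_tendsto_gamma hab hpar hne⟩
  obtain ⟨p, σ, ho⟩ := hI.exists_orientedComponent hf
  refine ⟨⟨p, ho.isRepellingEndpoint, fun r hr => ho.eq_of_isRepellingEndpoint hf hr⟩,
    fun r hr => ?_⟩
  obtain rfl := ho.eq_of_isRepellingEndpoint hf hr
  exact ⟨_, ho.isSzekeresField_field hab hf hpar, ho.continuousOn_field hab hf hpar,
    fun Y hY => ho.eqOn_field hab hf hpar hY⟩
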